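/- A stochastic game $\mathcal G$ consists of a finite non-empty set $S=S_{\mathsf{Max}}\uplus S_{\mathsf{Min}}$ of states, a finite set $L$ of action labels, a non-empty set $\mathsf{Act}(s)\subseteq L$ of available actions for every $s\in S$, and a probability distribution $P(s,a)$ on $S$ for every $s\in S$, $a\in\mathsf{Act}(s)$. A strategy $\sigma$ of $\mathsf{Max}$ maps every history in $(S\times L)^*$ followed by a state $s\in S_{\mathsf{Max}}$ to a probability distribution on $\mathsf{Act}(s)$; strategies $\tau$ of $\mathsf{Min}$ are defined in the same way with $S_{\mathsf{Min}}$. Let $\mathbb P^{\sigma,\tau}_s$ be the induced probability measure on infinite paths that start in $s$. For $T\subseteq S$, $\mathsf{Reach}(T)$ is the event that $T$ is visited and $\mathsf{Safe}(T)$ is its complement. For $S'\subseteq S$ and $q:S'\to[0,1]$ put $$\mathbb P^{\sigma,\tau}_s(\mathsf{Reach}(q))=\sum_{t\in S'}\mathbb P^{\sigma,\tau}_s\big((S\setminus S')\,\mathsf U\,t\big)\,q(t),\qquad \mathbb P^{\sigma,\tau}_s(\mathsf{Safe}(q))=1-\mathbb P^{\sigma,\tau}_s(\mathsf{Reach}(q)),$$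 where $(S\setminus S')\,\mathsf U\,t$ is the event that $t$ is visited and all states before it are in $S\setminus S'$. For a vector $\Omega=(\Omega_1,\dots,\Omega_n)$ of such (ordinary or quantified) objectives, the lex-value at $s$ is $${}^{\Omega}\mathbf v^{\mathsf{lex}}(s)=\sup_{\sigma}\inf_{\tau}\big(\mathbb P^{\sigma,\tau}_s(\Omega_1),\dots,\mathbb P^{\sigma,\tau}_s(\Omega_n)\big),$$ where $\sigma$ and $\tau$ range over all strategies of $\mathsf{Max}$ and $\mathsf{Min}$, and supremum and infimum are taken in the lexicographic order on $[0,1]^n$. Let $\Omega=(\Omega_1,\dots,\Omega_n)$ be a lex-objective, that is, $\Omega_i\in\{\mathsf{Reach}(S_i),\mathsf{Safe}(S_i)\}$ with arbitrary sets $S_i\subseteq S$. For $s\in S$ let $\Omega(s)$ be the stage obtained from $\Omega$ by removing all $\Omega_i$ with $s\in S_i$; the components of its lex-value keep their original indices. For $1\le i\le n$ define $q_i:\bigcup_{j\le n}S_j\to[0,1]$ by $$q_i(s)=\begin{cases}1 & \text{if } s\in S_i,\\ {}^{\Omega(s)}\mathbf v^{\mathsf{lex}}_i(s) & \text{if } s\notin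 S_i \text{ and } \Omega_i=\mathsf{Reach}(S_i),\\ 1-{}^{\Omega(s)}\mathbf v^{\mathsf{lex}}_i(s) & \text{if } s\notin S_i\text{ and } \Omega_i=\mathsf{Safe}(S_i),\end{cases}$$ and let $\mathsf q\Omega$ be the vector whose $i$-th entry is $\mathsf{Reach}(q_i)$ if $\Omega_i=\mathsf{Reach}(S_i)$ and $\mathsf{Safe}(q_i)$ if $\Omega_i=\mathsf{Safe}(S_i)$. \textbf{Lemma.} For every stochastic game $\mathcal G$, every lex-objective $\Omega$ and every state $s$, $${}^{\Omega}\mathbf v^{\mathsf{lex}}(s)={}^{\mathsf q\Omega}\mathbf v^{\mathsf{lex}}(s).$$ -/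

import Mathlib

open MeasureTheory ProbabilityTheory

namespace LexGame

/-! ### Stochastic games, strategies and the induced path measure -/

/-- The two players. -/
inductive Player where
  | max
  | min

/-- A turn-based stochastic game with states `S` and action labels `L` (both taken finite below).
`owner` partitions the states into those of the two players, `Act s` is the non-empty set of
actions available at `s`, and `P s a` is the distribution of the successor when `a ∈ Act s`.
For `a ∉ Act s` the value of `P s a` is irrelevant, since strategies only use available actions. -/
structure StochasticGame (S L : Type*) where
  owner : S → Player
  Act : S → Set L
  act_nonempty : ∀ s, (Act s).Nonempty
  P : S → L → PMF S

/-- A state together with the action chosen there, that is, an element of `S × L`. -/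
structure Step (S L : Type*) where
  state : S
  action : L

/-- All sets of steps are measurable. -/
instance Step.instMeasurableSpace {S L : Type*} : MeasurableSpace (Step S L) := ⊤

instance Step.instDiscreteMeasurableSpace {S L : Type*} : DiscreteMeasurableSpace (Step S L) :=
  ⟨fun _ => trivial⟩

instance Step.instFinite {S L : Type*} [Finite S] [Finite L] : Finite (Step S L) :=
  Finite.of_injective (fun x : Step S L => (x.state, x.action)) (by
    rintro ⟨s, a⟩ ⟨s', a'⟩ h
    simpa using h)

/-- A (history-dependent, randomized) strategy of player `p`: it maps a history
`(s₀, a₀), …, (s_{k-1}, a_{k-1})` and a current state of player `p` to a distribution over the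
actions available in the current state. -/
structure Strategy {S L : Type*} (G : StochasticGame S L) (p : Player) where
  choice : List (Step S L) → {s : S // G.owner s = p} → PMF L
  support_subset : ∀ h s, (choice h s).support ⊆ G.Act s

variable {S L : Type*}

/-- The distribution of the action taken in state `s` after history `h`. -/
noncomputable def actionDist (G : StochasticGame S L) (σ : Strategy G Player.max)
    (τ : Strategy G Player.min) (h : List (Step S L)) (s : S) : PMF L :=
  match hs : G.owner s with
  | Player.max => σ.choice h ⟨s, hs⟩
  | Player.min => τ.choice h ⟨s, hs⟩

/-- The distribution of the step taken in state `s` after history `h`. -/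
noncomputable def stepDist (G : StochasticGame S L) (σ : Strategy G Player.max)
    (τ : Strategy G Player.min) (h : List (Step S L)) (s : S) : PMF (Step S L) :=
  (actionDist G σ τ h s).map (fun a => ⟨s, a⟩)

/-- The initial segment `x₀, …, xₙ` as a list. -/
def historyOf {n : ℕ} (x : (i : Finset.Iic n) → Step S L) : List (Step S L) :=
  List.ofFn (fun i : Fin (n + 1) => x ⟨i, Finset.mem_Iic.2 (Nat.lt_succ_iff.1 i.2)⟩)

/-- The distribution of step `n + 1` given the steps `0, …, n`: the successor state is drawn from
`P sₙ aₙ`, and then its owner draws an action. -/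
noncomputable def nextDist (G : StochasticGame S L) (σ : Strategy G Player.max)
    (τ : Strategy G Player.min) {n : ℕ} (x : (i : Finset.Iic n) → Step S L) : PMF (Step S L) :=
  (G.P (x ⟨n, Finset.mem_Iic.2 le_rfl⟩).state (x ⟨n, Finset.mem_Iic.2 le_rfl⟩).action).bind
    (stepDist G σ τ (historyOf x))

/-- `nextDist` as a Markov kernel. -/
noncomputable def stepKernel [Finite S] [Finite L] (G : StochasticGame S L)
    (σ : Strategy G Player.max) (τ : Strategy G Player.min) (n : ℕ) :
    Kernel ((i : Finset.Iic n) → Step S L) (Step S L) :=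
  Kernel.ofFunOfCountable (fun x => (nextDist G σ τ x).toMeasure)

instance stepKernel.instIsMarkovKernel [Finite S] [Finite L] (G : StochasticGame S L)
    (σ : Strategy G Player.max) (τ : Strategy G Player.min) (n : ℕ) :
    IsMarkovKernel (stepKernel G σ τ n) :=
  ⟨fun x => PMF.toMeasure.isProbabilityMeasure (nextDist G σ τ x)⟩

/-- The probability measure on infinite paths `s₀ a₀ s₁ a₁ …` with `s₀ = s` that is induced by the
strategies `σ` and `τ`. -/
noncomputable def pathMeasure [Finite S] [Finite L] (G : StochasticGame S L)
    (σ : Strategy G Player.max) (τ : Strategy G Player.min) (s : S) : Measure (ℕ → Step S L) :=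
  Kernel.trajMeasure (X := fun _ => Step S L) (stepDist G σ τ [] s).toMeasure (stepKernel G σ τ)

instance pathMeasure.instIsProbabilityMeasure [Finite S] [Finite L] (G : StochasticGame S L)
    (σ : Strategy G Player.max) (τ : Strategy G Player.min) (s : S) :
    IsProbabilityMeasure (pathMeasure G σ τ s) := by
  have : IsProbabilityMeasure (stepDist G σ τ [] s).toMeasure :=
    PMF.toMeasure.isProbabilityMeasure _
  unfold pathMeasure
  infer_instance

/-- The event that the sequence of states of the path lies in `Φ`. -/
def pathEvent (L : Type*) (Φ : Set (ℕ → S)) : Set (ℕ → Step S L) :=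
  {ω | (fun i => (ω i).state) ∈ Φ}

/-- The probability `ℙ_s^{σ,τ}(Φ)` of a property `Φ` of infinite state sequences. -/
noncomputable def prob [Finite S] [Finite L] (G : StochasticGame S L) (σ : Strategy G Player.max)
    (τ : Strategy G Player.min) (s : S) (Φ : Set (ℕ → S)) : unitInterval :=
  ⟨(pathMeasure G σ τ s).real (pathEvent L Φ), measureReal_nonneg, measureReal_le_one⟩

/-! ### Reachability, safety and until properties -/

/-- Some state in `T` is visited. -/
def reach (T : Set S) : Set (ℕ → S) := {ρ | ∃ i, ρ i ∈ T}

/-- No state in `T` is ever visited. -/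
def safe (T : Set S) : Set (ℕ → S) := (reach T)ᶜ

/-- `T₂` is visited, and all states before that are in `T₁`. -/
def untilProp (T₁ T₂ : Set S) : Set (ℕ → S) := {ρ | ∃ i, ρ i ∈ T₂ ∧ ∀ j < i, ρ j ∈ T₁}

/-- The type of an objective. -/
inductive ObjKind where
  | reach
  | safe

/-- A reachability or safety objective with target set `target`. -/
structure Objective (S : Type*) where
  kind : ObjKind
  target : Set S

/-- The property of an objective. -/
def Objective.property (Ω : Objective S) : Set (ℕ → S) :=
  match Ω.kind with
  | ObjKind.reach => LexGame.reach Ω.target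
  | ObjKind.safe => LexGame.safe Ω.target

/-- A quantified reachability or safety objective, given by a weight function
`q : S' → [0,1]` on a set `S' = domain` of states. -/
structure QuantObjective (S : Type*) where
  kind : ObjKind
  domain : Set S
  weight : domain → unitInterval

theorem measurableSet_pathEvent_untilProp (T₁ T₂ : Set S) :
    MeasurableSet (pathEvent L (untilProp T₁ T₂)) := by
  have h : pathEvent L (untilProp T₁ T₂) =
      ⋃ i : ℕ, ((fun ω : ℕ → Step S L => ω i) ⁻¹' {x | x.state ∈ T₂}) ∩
        ⋂ j : ℕ, ⋂ _ : j < i, (fun ω : ℕ → Step S L => ω j) ⁻¹' {x | x.state ∈ T₁} := by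
    ext ω
    simp [pathEvent, untilProp]
  rw [h]
  refine MeasurableSet.iUnion fun i => MeasurableSet.inter ?_ ?_
  · exact measurable_pi_apply i (MeasurableSet.of_discrete)
  · exact MeasurableSet.iInter fun j => MeasurableSet.iInter fun _ =>
      measurable_pi_apply j (MeasurableSet.of_discrete)

open Classical in
/-- `ℙ_s^{σ,τ}(Reach(q)) = ∑_{t ∈ S'} ℙ_s^{σ,τ}((S \ S') U t) · q(t)`, as a real number. -/
noncomputable def quantReachReal [Fintype S] [Finite L] (G : StochasticGame S L)
    (σ : Strategy G Player.max) (τ : Strategy G Player.min) (s : S) (D : Set S)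
    (q : D → unitInterval) : ℝ :=
  ∑ t : D, (prob G σ τ s (untilProp Dᶜ {(t : S)}) : ℝ) * (q t : ℝ)

theorem quantReachReal_mem [Fintype S] [Finite L] (G : StochasticGame S L)
    (σ : Strategy G Player.max) (τ : Strategy G Player.min) (s : S) (D : Set S)
    (q : D → unitInterval) : quantReachReal G σ τ s D q ∈ Set.Icc (0 : ℝ) 1 := by
  classical
  unfold quantReachReal
  refine ⟨Finset.sum_nonneg fun t _ => mul_nonneg (prob _ _ _ _ _).2.1 (q t).2.1, ?_⟩
  have hdisj : Set.PairwiseDisjoint (↑(Finset.univ : Finset D))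
      (fun t : D => pathEvent L (untilProp Dᶜ {(t : S)})) := by
    intro t _ t' _ htt'
    refine Set.disjoint_left.2 ?_
    rintro ω ⟨i, hi, hi'⟩ ⟨j, hj, hj'⟩
    simp only [Set.mem_singleton_iff] at hi hj
    rcases lt_trichotomy i j with h | h | h
    · exact hj' i h (by simpa only [hi] using t.2)
    · subst h
      exact htt' (Subtype.ext (hi.symm.trans hj))
    · exact hi' j h (by simpa only [hj] using t'.2)
  calc ∑ t : D, (prob G σ τ s (untilProp Dᶜ {(t : S)}) : ℝ) * (q t : ℝ)
      ≤ ∑ t : D, (pathMeasure G σ τ s).real (pathEvent L (untilProp Dᶜ {(t : S)})) :=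
        Finset.sum_le_sum fun t _ => mul_le_of_le_one_right (prob _ _ _ _ _).2.1 (q t).2.2
    _ = (pathMeasure G σ τ s).real
          (⋃ t ∈ (Finset.univ : Finset D), pathEvent L (untilProp Dᶜ {(t : S)})) :=
        (measureReal_biUnion_finset hdisj
          fun t _ => measurableSet_pathEvent_untilProp _ _).symm
    _ ≤ 1 := measureReal_le_one

/-- `ℙ_s^{σ,τ}(Reach(q))` for a reachability kind and
`ℙ_s^{σ,τ}(Safe(q)) = 1 - ℙ_s^{σ,τ}(Reach(q))` for a safety kind. -/
noncomputable def QuantObjective.prob [Fintype S] [Finite L] (Q : QuantObjective S)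
    (G : StochasticGame S L) (σ : Strategy G Player.max) (τ : Strategy G Player.min) (s : S) :
    unitInterval :=
  match Q.kind with
  | ObjKind.reach =>
      ⟨quantReachReal G σ τ s Q.domain Q.weight, quantReachReal_mem G σ τ s Q.domain Q.weight⟩
  | ObjKind.safe =>
      unitInterval.symm
        ⟨quantReachReal G σ τ s Q.domain Q.weight, quantReachReal_mem G σ τ s Q.domain Q.weight⟩

/-! ### The lexicographic order on `[0,1]^ι` and lex-values

The index set `ι` of a vector is a finite linear order, such as `Fin n` or a subset of it; the
smallest index is the most important one. -/

section Lex

variable {ι : Type*} [Finite ι] [LinearOrder ι]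

/-- Vectors in `[0,1]^ι` with the lexicographic order. -/
abbrev LexVec (ι : Type*) : Type _ := Lex (ι → unitInterval)

theorem exists_isLUB_lexVec (X : Set (LexVec ι)) : ∃ x, IsLUB X x := by
  have hwf : WellFounded ((· < ·) : ι → ι → Prop) := wellFounded_lt
  let F : (i : ι) → ((j : ι) → j < i → unitInterval) → unitInterval :=
    fun i f => sSup {r | ∃ y ∈ X, (∀ j (h : j < i), y j = f j h) ∧ y i = r}
  let x : LexVec ι := toLex (hwf.fix F)
  have hx : ∀ i, x i = sSup {r | ∃ y ∈ X, (∀ j < i, y j = x j) ∧ y i = r} :=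
    fun i => hwf.fix_eq F i
  refine ⟨x, fun y hy => ?_, fun b hb => ?_⟩
  · by_contra hlt
    obtain ⟨i, hi, hi'⟩ := not_le.1 hlt
    refine absurd hi' (not_lt.2 ?_)
    rw [hx i]
    exact le_sSup ⟨y, hy, fun j hj => (hi j hj).symm, rfl⟩
  · by_contra hlt
    obtain ⟨i, hi, hi'⟩ := not_le.1 hlt
    rw [hx i] at hi'
    obtain ⟨r, ⟨y, hy, hyx, rfl⟩, hr⟩ := lt_sSup_iff.1 hi'
    exact absurd (hb hy) (not_le.2 ⟨i, fun j hj => (hi j hj).trans (hyx j hj).symm, hr⟩)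

theorem exists_isGLB_lexVec (X : Set (LexVec ι)) : ∃ x, IsGLB X x := by
  obtain ⟨x, hx⟩ := exists_isLUB_lexVec (lowerBounds X)
  exact ⟨x, isLUB_lowerBounds.1 hx⟩

/-- The supremum in the lexicographic order on `[0,1]^ι`. -/
noncomputable def lexSup (X : Set (LexVec ι)) : LexVec ι := (exists_isLUB_lexVec X).choose

/-- The infimum in the lexicographic order on `[0,1]^ι`. -/
noncomputable def lexInf (X : Set (LexVec ι)) : LexVec ι := (exists_isGLB_lexVec X).choose

theorem isLUB_lexSup (X : Set (LexVec ι)) : IsLUB X (lexSup X) :=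
  (exists_isLUB_lexVec X).choose_spec

theorem isGLB_lexInf (X : Set (LexVec ι)) : IsGLB X (lexInf X) :=
  (exists_isGLB_lexVec X).choose_spec

/-- `sup_σ inf_τ p σ τ` in the lexicographic order. -/
noncomputable def lexSupInf {G : StochasticGame S L}
    (p : Strategy G Player.max → Strategy G Player.min → LexVec ι) : LexVec ι :=
  lexSup (Set.range fun σ => lexInf (Set.range fun τ => p σ τ))

/-- The lex-value of a lex-objective `Ω` at `s`. -/
noncomputable def lexValue [Finite S] [Finite L] (G : StochasticGame S L) (Ω : ι → Objective S)
    (s : S) : LexVec ι :=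
  lexSupInf fun σ τ => toLex fun i => prob G σ τ s (Ω i).property

/-- The lex-value of a vector `Q` of quantified objectives at `s`. -/
noncomputable def quantLexValue [Fintype S] [Finite L] (G : StochasticGame S L)
    (Q : ι → QuantObjective S) (s : S) : LexVec ι :=
  lexSupInf fun σ τ => toLex fun i => (Q i).prob G σ τ s

/-- The stage `Ω(I)`: the objectives with index in `I` are removed, the others keep their order. -/
def stage (Ω : ι → Objective S) (I : Set ι) : {i : ι // i ∉ I} → Objective S :=
  fun i => Ω i

/-- The set `{i | s ∈ S_i}` of the objectives whose target set contains `s`. -/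
def visited (Ω : ι → Objective S) (s : S) : Set ι := {i | s ∈ (Ω i).target}

open Classical in
/-- The weight function `q_i : ⋃ j, S_j → [0,1]`: it is `1` on `S_i`, and elsewhere it is given by
the component with index `i` of the lex-value of the stage `Ω(s)` at `s`. -/
noncomputable def stageWeight [Finite S] [Finite L] (G : StochasticGame S L) (Ω : ι → Objective S)
    (i : ι) (s : (⋃ j, (Ω j).target : Set S)) : unitInterval :=
  if h : (s : S) ∈ (Ω i).target then 1
  else
    match (Ω i).kind with
    | ObjKind.reach => lexValue G (stage Ω (visited Ω s)) s ⟨i, h⟩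
    | ObjKind.safe => unitInterval.symm (lexValue G (stage Ω (visited Ω s)) s ⟨i, h⟩)

/-- The vector `qΩ` of quantified objectives; each keeps the type of the original objective. -/
noncomputable def quantObjectives [Finite S] [Finite L] (G : StochasticGame S L)
    (Ω : ι → Objective S) : ι → QuantObjective S :=
  fun i => ⟨(Ω i).kind, ⋃ j, (Ω j).target, stageWeight G Ω i⟩

end Lex

end LexGame

/-! The game with objective Ω has a lexicographic saddle point (σ₀, τ₀) that serves all initial
states at once and whose strategies remember only the set of targets visited so far
(`exists_lex_saddle`). Everything else is read off from this pair.

Let D be the union of the targets. Before D is visited the memory is empty, so σ₀ and τ₀ act after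
the first visit to t ∈ D as if the play started in t. At t the objectives with t in their target
have a constant probability, so the saddle inequality survives their removal, and the lex-value of
the stage at t is the payoff of (σ₀, τ₀) from t (`lexValue_stage_eq_of_saddle`). Thus q_i(t) is the
probability of reaching S_i from t under (σ₀, τ₀), for both kinds of objectives. It follows that the
quantified payoff of any pair (σ, τ) is the ordinary payoff of the pair that switches to (σ₀, τ₀) at
the first visit to D (`prob_reach_switch`). Since σ₀ and τ₀ are unchanged by switching to
themselves, the saddle inequality for Ω applied to the switched strategies is the one for qΩ, with
the same payoff at (σ₀, τ₀). A payoff at a saddle point is the value, so both values coincide.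

The saddle point comes from two limits. For real weights on the objectives and a discount factor β <
1, the optimality equation over pairs (state, memory) is a contraction, and best actions at its
fixed point form a saddle point. There are only finitely many memory selectors, so one of them works
for β arbitrarily close to 1, hence for the undiscounted weighted sum by Abel's theorem. With
weights ±ε^i, one selector again works for arbitrarily small ε > 0, and such an inequality of
weighted sums forces the lexicographic one. -/

namespace LexGame

open Filter Topology

/-! ### The one-step decomposition of the path measure -/

section PathMeasure

variable {S L : Type*} {G : StochasticGame S L}

/-- The residual strategy after the step `x`. -/
def Strategy.shift {p : Player} (σ : Strategy G p) (x : Step S L) : Strategy G p where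
  choice h s := σ.choice (x :: h) s
  support_subset h s := σ.support_subset (x :: h) s

theorem actionDist_shift (σ : Strategy G Player.max) (τ : Strategy G Player.min) (x : Step S L)
    (h : List (Step S L)) (s : S) :
    actionDist G (σ.shift x) (τ.shift x) h s = actionDist G σ τ (x :: h) s := by
  unfold actionDist
  split <;> rfl

theorem stepDist_shift (σ : Strategy G Player.max) (τ : Strategy G Player.min) (x : Step S L)
    (h : List (Step S L)) (s : S) :
    stepDist G (σ.shift x) (τ.shift x) h s = stepDist G σ τ (x :: h) s := by
  unfold stepDist
  rw [actionDist_shift]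

theorem stepDist_apply (σ : Strategy G Player.max) (τ : Strategy G Player.min)
    (h : List (Step S L)) (s : S) (a : L) :
    stepDist G σ τ h s ⟨s, a⟩ = actionDist G σ τ h s a := by
  classical
  unfold stepDist
  rw [PMF.map_apply, tsum_eq_single a]
  · simp
  · intro b hb
    simp [hb.symm]

theorem stepDist_apply_of_ne (σ : Strategy G Player.max) (τ : Strategy G Player.min)
    (h : List (Step S L)) {s : S} {x : Step S L} (hx : x.state ≠ s) :
    stepDist G σ τ h s x = 0 := by
  classical
  unfold stepDist
  rw [PMF.map_apply, ENNReal.tsum_eq_zero]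
  intro a
  rw [if_neg]
  rintro rfl
  exact hx rfl

/-- The path with first step `x` that continues as `ω`. -/
def consPath {X : Type*} (x : X) (ω : ℕ → X) : ℕ → X
  | 0 => x
  | n + 1 => ω n

theorem measurable_consPath {X : Type*} [MeasurableSpace X] (x : X) :
    Measurable (consPath x) := by
  refine measurable_pi_iff.2 fun n => ?_
  cases n with
  | zero => exact measurable_const
  | succ n => exact measurable_pi_apply n

theorem consPath_mem_prefix {X : Type*} (x : X) (ω y : ℕ → X) (n : ℕ) :
    (∀ i ≤ n + 1, consPath x ω i = y i) ↔ x = y 0 ∧ ∀ i ≤ n, ω i = y (i + 1) := by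
  constructor
  · intro h
    exact ⟨h 0 (Nat.zero_le _), fun i hi => h (i + 1) (Nat.succ_le_succ hi)⟩
  · rintro ⟨h0, h⟩ i hi
    cases i with
    | zero => exact h0
    | succ i => exact h i (Nat.le_of_succ_le_succ hi)

theorem measurableSet_prefix {X : Type*} [MeasurableSpace X] [MeasurableSingletonClass X]
    (y : ℕ → X) (n : ℕ) : MeasurableSet {ω : ℕ → X | ∀ i ≤ n, ω i = y i} := by
  have : {ω : ℕ → X | ∀ i ≤ n, ω i = y i} =
      ⋂ i : ℕ, ⋂ _ : i ≤ n, (fun ω : ℕ → X => ω i) ⁻¹' {y i} := by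
    ext ω; simp
  rw [this]
  exact MeasurableSet.iInter fun i => MeasurableSet.iInter fun _ =>
    measurable_pi_apply i (measurableSet_singleton _)

/-- Finite measures on sequences in a finite type agree if they agree on all prefixes. -/
theorem measure_eq_of_prefix {X : Type*} [Finite X] [MeasurableSpace X] [DiscreteMeasurableSpace X]
    {μ ν : Measure (ℕ → X)} [IsFiniteMeasure μ] [IsFiniteMeasure ν]
    (h : ∀ (y : ℕ → X) (n : ℕ), μ {ω | ∀ i ≤ n, ω i = y i} = ν {ω | ∀ i ≤ n, ω i = y i}) :
    μ = ν := by
  have hμ : IsProjectiveLimit μ (fun I : Finset ℕ => μ.map I.restrict) := fun I => rfl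
  have hf : IsProjectiveMeasureFamily (α := fun _ : ℕ => X)
      (fun I : Finset ℕ => μ.map I.restrict) := by
    intro I J hJI
    rw [Measure.map_map (by fun_prop) (by fun_prop)]
    rfl
  have hν : IsProjectiveLimit ν (fun I : Finset ℕ => μ.map I.restrict) := by
    refine (isProjectiveLimit_nat_iff (X := fun _ => X) hf ν).2 fun n => ?_
    refine Measure.ext_of_singleton fun x => ?_
    -- The tuple `x` is extended beyond `n` by its last entry; the extension is irrelevant, as only
    -- indices up to `n` are compared.
    have hx : ∀ κ : Measure (ℕ → X), κ.map (Preorder.frestrictLe n) {x} =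
        κ {ω | ∀ i ≤ n, ω i = (fun i => if hi : i ≤ n then x ⟨i, Finset.mem_Iic.2 hi⟩
          else x ⟨n, Finset.mem_Iic.2 le_rfl⟩) i} := by
      intro κ
      rw [Measure.map_apply (by fun_prop) (measurableSet_singleton x)]
      congr 1
      ext ω
      simp only [Set.mem_preimage, Set.mem_singleton_iff, Set.mem_ofPred_eq]
      constructor
      · rintro rfl i hi
        simp [hi, Preorder.frestrictLe]
      · intro hω
        ext ⟨i, hi⟩
        have := hω i (Finset.mem_Iic.1 hi)
        rw [dif_pos (Finset.mem_Iic.1 hi)] at this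
        exact this
    have h1 := hx ν
    have h2 := hx μ
    rw [← h] at h1
    exact h1.trans h2.symm
  exact hμ.unique hν

/-- A prefix of length one is the disjoint union of its extensions by a second letter. This removes
the base case, to which the first-step recursion does not apply. -/
theorem measure_eq_of_prefix_succ {X : Type*} [Finite X] [MeasurableSpace X]
    [DiscreteMeasurableSpace X] {μ ν : Measure (ℕ → X)} [IsFiniteMeasure μ] [IsFiniteMeasure ν]
    (h : ∀ (y : ℕ → X) (n : ℕ),
      μ {ω | ∀ i ≤ n + 1, ω i = y i} = ν {ω | ∀ i ≤ n + 1, ω i = y i}) :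
    μ = ν := by
  have := Fintype.ofFinite X
  refine measure_eq_of_prefix fun y n => ?_
  cases n with
  | succ n => exact h y n
  | zero =>
    have hκ : ∀ κ : Measure (ℕ → X), κ {ω | ∀ i ≤ 0, ω i = y i} =
        ∑ x : X, κ {ω | ∀ i ≤ 0 + 1, ω i = consPath (y 0) (fun _ => x) i} := by
      intro κ
      rw [← measure_biUnion_finset]
      · congr 1
        ext ω
        simp [Nat.le_one_iff_eq_zero_or_eq_one, consPath]
      · intro x _ x' _ hxx'
        refine Set.disjoint_left.2 fun ω hω hω' => hxx' ?_
        exact (hω 1 le_rfl).symm.trans (hω' 1 le_rfl)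
      · exact fun x _ => measurableSet_prefix _ _
    rw [hκ, hκ]
    exact Finset.sum_congr rfl fun x _ => h _ _

theorem sum_pmf {X : Type*} [Fintype X] (p : PMF X) : ∑ x, p x = 1 :=
  (tsum_fintype _).symm.trans p.tsum_coe

theorem sum_pmf_toReal {X : Type*} [Fintype X] (p : PMF X) : ∑ x, (p x).toReal = 1 := by
  rw [← ENNReal.toReal_sum fun x _ => PMF.apply_ne_top p x, sum_pmf, ENNReal.toReal_one]

theorem nextDist_prefix_zero [Fintype S] (σ : Strategy G Player.max) (τ : Strategy G Player.min)
    (y : ℕ → Step S L) (x : Step S L) :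
    nextDist G σ τ (fun i : Finset.Iic 0 => y i) x =
      ∑ s' : S, G.P (y 0).state (y 0).action s' *
        stepDist G (σ.shift (y 0)) (τ.shift (y 0)) [] s' x := by
  unfold nextDist
  rw [PMF.bind_apply, tsum_fintype]
  refine Finset.sum_congr rfl fun s' _ => ?_
  rw [stepDist_shift]
  congr 2

theorem nextDist_prefix_succ (σ : Strategy G Player.max) (τ : Strategy G Player.min)
    (y : ℕ → Step S L) (n : ℕ) :
    nextDist G σ τ (fun i : Finset.Iic (n + 1) => y i) =
      nextDist G (σ.shift (y 0)) (τ.shift (y 0)) (fun i : Finset.Iic n => y (i + 1)) := by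
  unfold nextDist
  congr 1
  funext s'
  rw [stepDist_shift]
  congr 1
  unfold historyOf
  rw [List.ofFn_succ]
  rfl

variable [Finite S] [Finite L]

theorem pathMeasure_prefix_zero (σ : Strategy G Player.max) (τ : Strategy G Player.min) (s : S)
    (y : ℕ → Step S L) :
    pathMeasure G σ τ s {ω | ∀ i ≤ 0, ω i = y i} = stepDist G σ τ [] s (y 0) := by
  have hp : IsProbabilityMeasure (stepDist G σ τ [] s).toMeasure :=
    PMF.toMeasure.isProbabilityMeasure _
  have hmap : (pathMeasure G σ τ s).map (Preorder.frestrictLe (π := fun _ => Step S L) 0) =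
      (stepDist G σ τ [] s).toMeasure.map
        (MeasurableEquiv.piUnique (fun _ : Finset.Iic 0 => Step S L)).symm := by
    unfold pathMeasure Kernel.trajMeasure
    rw [Measure.map_comp _ _ (by fun_prop), Kernel.traj_map_frestrictLe, Kernel.partialTraj_self,
      Measure.id_comp]
  have hset := congrArg (fun μ => μ ((fun x : Finset.Iic 0 → Step S L =>
    x ⟨0, Finset.mem_Iic.2 le_rfl⟩) ⁻¹' {y 0})) hmap
  beta_reduce at hset
  rw [Measure.map_apply (by fun_prop) (MeasurableSet.of_discrete),
    Measure.map_apply (by fun_prop) (MeasurableSet.of_discrete)] at hset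
  have h1 : {ω : ℕ → Step S L | ∀ i ≤ 0, ω i = y i} =
      Preorder.frestrictLe (π := fun _ => Step S L) 0 ⁻¹' ((fun x : Finset.Iic 0 → Step S L =>
        x ⟨0, Finset.mem_Iic.2 le_rfl⟩) ⁻¹' {y 0}) := by
    ext ω
    simp [Preorder.frestrictLe]
  rw [h1, hset, ← PMF.toMeasure_apply_singleton _ _ (measurableSet_singleton _)]
  rfl

theorem pathMeasure_prefix_succ (σ : Strategy G Player.max) (τ : Strategy G Player.min) (s : S)
    (y : ℕ → Step S L) (n : ℕ) :
    pathMeasure G σ τ s {ω | ∀ i ≤ n + 1, ω i = y i} =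
      pathMeasure G σ τ s {ω | ∀ i ≤ n, ω i = y i} *
        nextDist G σ τ (fun i : Finset.Iic n => y i) (y (n + 1)) := by
  have hp : IsProbabilityMeasure (stepDist G σ τ [] s).toMeasure :=
    PMF.toMeasure.isProbabilityMeasure _
  have key := Kernel.map_frestrictLe_trajMeasure_compProd_eq_map_trajMeasure
    (X := fun _ => Step S L) (μ₀ := (stepDist G σ τ [] s).toMeasure)
    (κ := stepKernel G σ τ) (a := n)
  have hset := congrArg (fun μ => μ ({fun i : Finset.Iic n => y i} ×ˢ {y (n + 1)})) key
  beta_reduce at hset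
  rw [Measure.map_apply (by fun_prop) (MeasurableSet.of_discrete),
    Measure.compProd_apply_prod (MeasurableSet.of_discrete) (MeasurableSet.of_discrete),
    lintegral_singleton, Measure.map_apply (by fun_prop) (MeasurableSet.of_discrete)] at hset
  have h1 : {ω : ℕ → Step S L | ∀ i ≤ n + 1, ω i = y i} =
      (fun x : ℕ → Step S L => (Preorder.frestrictLe (π := fun _ => Step S L) n x, x (n + 1))) ⁻¹'
        ({fun i : Finset.Iic n => y i} ×ˢ {y (n + 1)}) := by
    ext ω
    simp only [Set.mem_ofPred_eq, Set.mem_preimage, Set.mem_prod, Set.mem_singleton_iff,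
      funext_iff, Subtype.forall, Finset.mem_Iic]
    constructor
    · exact fun h => ⟨fun i hi => h i (hi.trans n.le_succ), h _ le_rfl⟩
    · rintro ⟨h, h'⟩ i hi
      rcases Nat.le_succ_iff.1 hi with hi | rfl
      · exact h i hi
      · exact h'
  have h2 : {ω : ℕ → Step S L | ∀ i ≤ n, ω i = y i} =
      Preorder.frestrictLe (π := fun _ => Step S L) n ⁻¹' {fun i : Finset.Iic n => y i} := by
    ext ω
    simp only [Set.mem_ofPred_eq, Set.mem_preimage, Set.mem_singleton_iff,
      funext_iff, Subtype.forall, Finset.mem_Iic]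
    rfl
  rw [h1, h2, ← PMF.toMeasure_apply_singleton _ _ (measurableSet_singleton _)]
  refine hset.symm.trans ?_
  rw [mul_comm]
  rfl

/-- The construction of the measure extends a path at its end. Induction on the length turns this
into a recursion at its beginning, where the rest of the play is governed by the residual
strategies. -/
theorem pathMeasure_prefix_succ_shift [Fintype S] (σ : Strategy G Player.max)
    (τ : Strategy G Player.min) (s : S) (y : ℕ → Step S L) (n : ℕ) :
    pathMeasure G σ τ s {ω | ∀ i ≤ n + 1, ω i = y i} =
      stepDist G σ τ [] s (y 0) * ∑ s' : S, G.P (y 0).state (y 0).action s' *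
        pathMeasure G (σ.shift (y 0)) (τ.shift (y 0)) s' {ω | ∀ i ≤ n, ω i = y (i + 1)} := by
  induction n with
  | zero =>
    rw [pathMeasure_prefix_succ, pathMeasure_prefix_zero, nextDist_prefix_zero]
    congr 1
    refine Finset.sum_congr rfl fun s' _ => ?_
    rw [pathMeasure_prefix_zero _ _ _ (fun i => y (i + 1))]
  | succ n ih =>
    rw [pathMeasure_prefix_succ, ih, nextDist_prefix_succ, mul_assoc, Finset.sum_mul]
    congr 1
    refine Finset.sum_congr rfl fun s' _ => ?_
    rw [pathMeasure_prefix_succ _ _ _ (fun i => y (i + 1)), mul_assoc]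

theorem pathMeasure_eq_sum [Fintype S] [Fintype L] (σ : Strategy G Player.max)
    (τ : Strategy G Player.min) (s : S) :
    pathMeasure G σ τ s = ∑ a : L, actionDist G σ τ [] s a • ∑ s' : S, G.P s a s' •
      (pathMeasure G (σ.shift ⟨s, a⟩) (τ.shift ⟨s, a⟩) s').map (consPath ⟨s, a⟩) := by
  classical
  have happ : ∀ E : Set (ℕ → Step S L), MeasurableSet E →
      (∑ a : L, actionDist G σ τ [] s a • ∑ s' : S, G.P s a s' •
        (pathMeasure G (σ.shift ⟨s, a⟩) (τ.shift ⟨s, a⟩) s').map (consPath ⟨s, a⟩)) E =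
      ∑ a : L, actionDist G σ τ [] s a * ∑ s' : S, G.P s a s' *
        pathMeasure G (σ.shift ⟨s, a⟩) (τ.shift ⟨s, a⟩) s' (consPath ⟨s, a⟩ ⁻¹' E) := by
    intro E hE
    simp only [Measure.finsetSum_apply, Measure.smul_apply, smul_eq_mul,
      Measure.map_apply (measurable_consPath _) hE]
  -- Uniqueness from prefixes needs a finite measure; the mixture has total mass 1.
  have huniv : (∑ a : L, actionDist G σ τ [] s a • ∑ s' : S, G.P s a s' •
        (pathMeasure G (σ.shift ⟨s, a⟩) (τ.shift ⟨s, a⟩) s').map (consPath ⟨s, a⟩)) Set.univ = 1 := by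
    rw [happ _ MeasurableSet.univ]
    simp only [Set.preimage_univ, measure_univ, mul_one]
    simp only [sum_pmf, mul_one]
  have hfin : IsFiniteMeasure (∑ a : L, actionDist G σ τ [] s a • ∑ s' : S, G.P s a s' •
      (pathMeasure G (σ.shift ⟨s, a⟩) (τ.shift ⟨s, a⟩) s').map (consPath ⟨s, a⟩)) :=
    ⟨by rw [huniv]; exact ENNReal.one_lt_top⟩
  refine measure_eq_of_prefix_succ fun y n => ?_
  rw [happ _ (measurableSet_prefix y (n + 1)), pathMeasure_prefix_succ_shift]
  by_cases hs : (y 0).state = s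
  · rw [Finset.sum_eq_single (y 0).action]
    · subst hs
      have hpre : consPath (y 0) ⁻¹' {ω | ∀ i ≤ n + 1, ω i = y i} =
          {ω | ∀ i ≤ n, ω i = y (i + 1)} := by
        ext ω
        simp [consPath_mem_prefix]
      rw [← stepDist_apply, ← hpre]
    · intro a _ ha
      have hpre : consPath ⟨s, a⟩ ⁻¹' {ω | ∀ i ≤ n + 1, ω i = y i} = ∅ := by
        ext ω
        simp only [Set.mem_preimage, Set.mem_ofPred_eq, consPath_mem_prefix, Set.mem_empty_iff_false,
          iff_false, not_and]
        intro h
        exact absurd (by rw [← h]) ha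
      simp [hpre]
    · simp
  · rw [stepDist_apply_of_ne _ _ _ hs, zero_mul, eq_comm, Finset.sum_eq_zero]
    intro a _
    have hpre : consPath ⟨s, a⟩ ⁻¹' {ω | ∀ i ≤ n + 1, ω i = y i} = ∅ := by
      ext ω
      simp only [Set.mem_preimage, Set.mem_ofPred_eq, consPath_mem_prefix, Set.mem_empty_iff_false,
        iff_false, not_and]
      intro h
      exact absurd (by rw [← h]) hs
    simp [hpre]

/-- The one-step decomposition of probabilities of events of paths. -/
theorem pathMeasure_real_eq_sum [Fintype S] [Fintype L] (σ : Strategy G Player.max)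
    (τ : Strategy G Player.min) (s : S) {E : Set (ℕ → Step S L)} (hE : MeasurableSet E) :
    (pathMeasure G σ τ s).real E = ∑ a : L, (actionDist G σ τ [] s a).toReal *
      ∑ s' : S, (G.P s a s').toReal *
        (pathMeasure G (σ.shift ⟨s, a⟩) (τ.shift ⟨s, a⟩) s').real (consPath ⟨s, a⟩ ⁻¹' E) := by
  have hsum : ∀ a : L, ∑ s' : S, G.P s a s' *
      pathMeasure G (σ.shift ⟨s, a⟩) (τ.shift ⟨s, a⟩) s' (consPath ⟨s, a⟩ ⁻¹' E) ≠ ⊤ := fun a =>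
    ENNReal.sum_ne_top.2 fun s' _ => ENNReal.mul_ne_top (PMF.apply_ne_top _ _) (measure_ne_top _ _)
  rw [measureReal_def, pathMeasure_eq_sum]
  simp only [Measure.finsetSum_apply, Measure.smul_apply, smul_eq_mul,
    Measure.map_apply (measurable_consPath _) hE]
  rw [ENNReal.toReal_sum fun a _ => ENNReal.mul_ne_top (PMF.apply_ne_top _ _) (hsum a)]
  refine Finset.sum_congr rfl fun a _ => ?_
  rw [ENNReal.toReal_mul, ENNReal.toReal_sum fun s' _ =>
    ENNReal.mul_ne_top (PMF.apply_ne_top _ _) (measure_ne_top _ _)]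
  simp only [ENNReal.toReal_mul, measureReal_def]

end PathMeasure

/-! ### Hitting probabilities -/

section Hitting

variable {S L : Type*} {G : StochasticGame S L}

/-- The expectation of `f` at the first action and the successor state. -/
noncomputable def expectStep [Fintype S] [Fintype L] (σ : Strategy G Player.max)
    (τ : Strategy G Player.min) (s : S) (f : L → S → ℝ) : ℝ :=
  ∑ a : L, (actionDist G σ τ [] s a).toReal * ∑ s' : S, (G.P s a s').toReal * f a s'

section

variable [Fintype S] [Fintype L] (σ : Strategy G Player.max) (τ : Strategy G Player.min) (s : S)

theorem expectStep_mono {f g : L → S → ℝ} (h : ∀ a s', f a s' ≤ g a s') :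
    expectStep σ τ s f ≤ expectStep σ τ s g := by
  unfold expectStep
  gcongr
  exact h _ _

theorem expectStep_const (c : ℝ) : expectStep σ τ s (fun _ _ => c) = c := by
  simp [expectStep, ← Finset.sum_mul, sum_pmf_toReal]

theorem expectStep_zero : expectStep σ τ s (fun _ _ => 0) = 0 := expectStep_const σ τ s 0

theorem expectStep_add (f g : L → S → ℝ) :
    expectStep σ τ s (fun a s' => f a s' + g a s') =
      expectStep σ τ s f + expectStep σ τ s g := by
  simp only [expectStep, mul_add, Finset.sum_add_distrib]

theorem expectStep_mul_left (c : ℝ) (f : L → S → ℝ) :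
    expectStep σ τ s (fun a s' => c * f a s') = c * expectStep σ τ s f := by
  simp only [expectStep, Finset.mul_sum]
  refine Finset.sum_congr rfl fun a _ => Finset.sum_congr rfl fun s' _ => by ring

theorem expectStep_sum {κ : Type*} (t : Finset κ) (f : κ → L → S → ℝ) :
    expectStep σ τ s (fun a s' => ∑ i ∈ t, f i a s') = ∑ i ∈ t, expectStep σ τ s (f i) := by
  classical
  induction t using Finset.induction_on with
  | empty => simpa using expectStep_zero σ τ s
  | insert i t hi ih => simp only [Finset.sum_insert hi, expectStep_add, ih]

theorem hasSum_expectStep {f : ℕ → L → S → ℝ} {g : L → S → ℝ}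
    (h : ∀ a s', HasSum (fun n => f n a s') (g a s')) :
    HasSum (fun n => expectStep σ τ s (f n)) (expectStep σ τ s g) :=
  hasSum_sum fun a _ => (hasSum_sum fun s' _ => (h a s').mul_left _).mul_left _

end

/-- `T` is visited at time `n`, and `D` is not visited before. -/
def hitAt (D T : Set S) (n : ℕ) : Set (ℕ → S) := {ρ | ρ n ∈ T ∧ ∀ j < n, ρ j ∉ D}

theorem measurableSet_pathEvent_hitAt (D T : Set S) (n : ℕ) :
    MeasurableSet (pathEvent L (hitAt D T n)) := by
  have h : pathEvent L (hitAt D T n) =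
      ((fun ω : ℕ → Step S L => ω n) ⁻¹' {x | x.state ∈ T}) ∩
        ⋂ j : ℕ, ⋂ _ : j < n, (fun ω : ℕ → Step S L => ω j) ⁻¹' {x | x.state ∉ D} := by
    ext ω
    simp [pathEvent, hitAt]
  rw [h]
  refine MeasurableSet.inter (measurable_pi_apply n (MeasurableSet.of_discrete)) ?_
  exact MeasurableSet.iInter fun j => MeasurableSet.iInter fun _ =>
    measurable_pi_apply j (MeasurableSet.of_discrete)

/-- The probability that `T` is visited at time `n` and `D` is not visited before. -/
noncomputable def hitProb [Finite S] [Finite L] (σ : Strategy G Player.max)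
    (τ : Strategy G Player.min) (D T : Set S) (s : S) (n : ℕ) : ℝ :=
  (pathMeasure G σ τ s).real (pathEvent L (hitAt D T n))

theorem reach_eq_untilProp (T : Set S) : reach T = untilProp Tᶜ T := by
  classical
  ext ρ
  constructor
  · rintro ⟨i, hi⟩
    have hex : ∃ i, ρ i ∈ T := ⟨i, hi⟩
    exact ⟨Nat.find hex, Nat.find_spec hex, fun j hj => Nat.find_min hex hj⟩
  · rintro ⟨i, hi, -⟩
    exact ⟨i, hi⟩

theorem hitProb_nonneg [Finite S] [Finite L] (σ : Strategy G Player.max)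
    (τ : Strategy G Player.min) (D T : Set S) (s : S) (n : ℕ) : 0 ≤ hitProb σ τ D T s n :=
  measureReal_nonneg

/-- Since `T ⊆ D`, a visit to `T` at one time excludes a first visit at a later time, so the events
for different times are disjoint. -/
theorem hasSum_hitProb [Finite S] [Finite L] (σ : Strategy G Player.max)
    (τ : Strategy G Player.min) {D T : Set S} (hTD : T ⊆ D) (s : S) :
    HasSum (hitProb σ τ D T s) (prob G σ τ s (untilProp Dᶜ T) : ℝ) := by
  have hU : pathEvent L (untilProp Dᶜ T) = ⋃ n, pathEvent L (hitAt D T n) := by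
    ext ω
    simp [pathEvent, untilProp, hitAt]
  have hdisj : Pairwise (Function.onFun Disjoint fun n => pathEvent L (hitAt D T n)) := by
    intro i j hij
    refine Set.disjoint_left.2 ?_
    rintro ω ⟨hi, hi'⟩ ⟨hj, hj'⟩
    rcases lt_or_gt_of_ne hij with h | h
    · exact hj' i h (hTD hi)
    · exact hi' j h (hTD hj)
  have hμ := measure_iUnion (μ := pathMeasure G σ τ s) hdisj
    (fun n => measurableSet_pathEvent_hitAt D T n)
  have hne : ∑' n, pathMeasure G σ τ s (pathEvent L (hitAt D T n)) ≠ ⊤ := by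
    rw [← hμ]
    exact measure_ne_top _ _
  have hsum := ENNReal.hasSum_toReal hne
  rw [← ENNReal.tsum_toReal_eq fun n => measure_ne_top _ _, ← hμ, ← hU] at hsum
  exact hsum

/-! ### One-step recursions for hitting probabilities -/

section

variable [Fintype S] [Fintype L]

open Classical in
theorem hitProb_zero (σ : Strategy G Player.max) (τ : Strategy G Player.min) (D T : Set S) (s : S) :
    hitProb σ τ D T s 0 = if s ∈ T then 1 else 0 := by
  unfold hitProb
  rw [pathMeasure_real_eq_sum _ _ _ (measurableSet_pathEvent_hitAt D T 0)]
  have hpre : ∀ a : L, consPath (⟨s, a⟩ : Step S L) ⁻¹' pathEvent L (hitAt D T 0) =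
      if s ∈ T then Set.univ else ∅ := by
    intro a
    ext ω
    split_ifs with h <;> simp [pathEvent, hitAt, consPath, h]
  simp only [hpre]
  split_ifs <;> simp [sum_pmf_toReal]

theorem hitProb_succ_of_mem (σ : Strategy G Player.max) (τ : Strategy G Player.min) {D : Set S}
    (T : Set S) {s : S} (hs : s ∈ D) (n : ℕ) : hitProb σ τ D T s (n + 1) = 0 := by
  unfold hitProb
  rw [pathMeasure_real_eq_sum _ _ _ (measurableSet_pathEvent_hitAt D T (n + 1))]
  have hpre : ∀ a : L, consPath (⟨s, a⟩ : Step S L) ⁻¹' pathEvent L (hitAt D T (n + 1)) = ∅ := by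
    intro a
    ext ω
    simp only [Set.mem_preimage, Set.mem_empty_iff_false, iff_false]
    exact fun h => h.2 0 n.succ_pos hs
  simp [hpre]

theorem hitProb_succ_of_notMem (σ : Strategy G Player.max) (τ : Strategy G Player.min) {D : Set S}
    (T : Set S) {s : S} (hs : s ∉ D) (n : ℕ) :
    hitProb σ τ D T s (n + 1) = expectStep σ τ s fun a s' =>
      hitProb (σ.shift ⟨s, a⟩) (τ.shift ⟨s, a⟩) D T s' n := by
  unfold hitProb expectStep
  rw [pathMeasure_real_eq_sum _ _ _ (measurableSet_pathEvent_hitAt D T (n + 1))]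
  have hpre : ∀ a : L, consPath (⟨s, a⟩ : Step S L) ⁻¹' pathEvent L (hitAt D T (n + 1)) =
      pathEvent L (hitAt D T n) := by
    intro a
    ext ω
    constructor
    · rintro ⟨h, h'⟩
      exact ⟨h, fun j hj => h' (j + 1) (Nat.succ_lt_succ hj)⟩
    · rintro ⟨h, h'⟩
      refine ⟨h, fun j hj => ?_⟩
      cases j with
      | zero => exact hs
      | succ j => exact h' j (Nat.lt_of_succ_lt_succ hj)
  simp only [hpre]

open Classical in
theorem prob_untilProp_of_mem (σ : Strategy G Player.max) (τ : Strategy G Player.min)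
    {D T : Set S} (hTD : T ⊆ D) {s : S} (hs : s ∈ D) :
    (prob G σ τ s (untilProp Dᶜ T) : ℝ) = if s ∈ T then 1 else 0 := by
  have h := hasSum_hitProb σ τ hTD s
  refine h.unique ?_
  rw [← hitProb_zero σ τ D T s]
  refine hasSum_single 0 fun n hn => ?_
  obtain ⟨n, rfl⟩ := Nat.exists_eq_succ_of_ne_zero hn
  exact hitProb_succ_of_mem σ τ T hs n

theorem prob_untilProp_of_notMem (σ : Strategy G Player.max) (τ : Strategy G Player.min)
    {D T : Set S} (hTD : T ⊆ D) {s : S} (hs : s ∉ D) :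
    (prob G σ τ s (untilProp Dᶜ T) : ℝ) = expectStep σ τ s fun a s' =>
      (prob G (σ.shift ⟨s, a⟩) (τ.shift ⟨s, a⟩) s' (untilProp Dᶜ T) : ℝ) := by
  classical
  have h := (hasSum_nat_add_iff' 1).2 (hasSum_hitProb σ τ hTD s)
  simp only [hitProb_succ_of_notMem σ τ T hs, Finset.sum_range_one, hitProb_zero,
    if_neg fun hT => hs (hTD hT), sub_zero] at h
  exact h.unique (hasSum_expectStep σ τ s fun a s' => hasSum_hitProb _ _ hTD s')

/-- The probability that `T` is visited before time `n` and before any other state of `D`. -/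
noncomputable def hitBefore (σ : Strategy G Player.max) (τ : Strategy G Player.min) (D T : Set S)
    (s : S) (n : ℕ) : ℝ :=
  ∑ k ∈ Finset.range n, hitProb σ τ D T s k

theorem hitBefore_le (σ : Strategy G Player.max) (τ : Strategy G Player.min)
    {D T : Set S} (hTD : T ⊆ D) (s : S) (n : ℕ) :
    hitBefore σ τ D T s n ≤ prob G σ τ s (untilProp Dᶜ T) :=
  sum_le_hasSum _ (fun _ _ => hitProb_nonneg _ _ _ _ _ _) (hasSum_hitProb σ τ hTD s)

theorem tendsto_hitBefore (σ : Strategy G Player.max) (τ : Strategy G Player.min)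
    {D T : Set S} (hTD : T ⊆ D) (s : S) :
    Tendsto (hitBefore σ τ D T s) atTop (𝓝 (prob G σ τ s (untilProp Dᶜ T) : ℝ)) :=
  (hasSum_hitProb σ τ hTD s).tendsto_sum_nat

theorem hitBefore_succ_of_notMem (σ : Strategy G Player.max) (τ : Strategy G Player.min)
    {D T : Set S} (hTD : T ⊆ D) {s : S} (hs : s ∉ D) (n : ℕ) :
    hitBefore σ τ D T s (n + 1) = expectStep σ τ s fun a s' =>
      hitBefore (σ.shift ⟨s, a⟩) (τ.shift ⟨s, a⟩) D T s' n := by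
  classical
  unfold hitBefore
  rw [Finset.sum_range_succ', hitProb_zero, if_neg fun hT => hs (hTD hT), add_zero, expectStep_sum]
  exact Finset.sum_congr rfl fun k _ => hitProb_succ_of_notMem σ τ T hs k

theorem prob_reach_eq_one (σ : Strategy G Player.max) (τ : Strategy G Player.min) {T : Set S}
    {s : S} (hs : s ∈ T) : (prob G σ τ s (reach T) : ℝ) = 1 := by
  rw [reach_eq_untilProp, prob_untilProp_of_mem σ τ subset_rfl hs, if_pos hs]

theorem prob_safe (σ : Strategy G Player.max) (τ : Strategy G Player.min) (T : Set S)
    (s : S) : (prob G σ τ s (safe T) : ℝ) = 1 - prob G σ τ s (reach T) := by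
  have hm : MeasurableSet (pathEvent L (reach T)) := by
    rw [reach_eq_untilProp]
    exact measurableSet_pathEvent_untilProp _ _
  exact probReal_compl_eq_one_sub hm

/-- The path measure only depends on the choices at histories that begin in the initial state. -/
theorem pathMeasure_congr {σ σ' : Strategy G Player.max} {τ τ' : Strategy G Player.min} {s : S}
    (h0 : actionDist G σ τ [] s = actionDist G σ' τ' [] s)
    (hσ : ∀ a, σ.shift ⟨s, a⟩ = σ'.shift ⟨s, a⟩) (hτ : ∀ a, τ.shift ⟨s, a⟩ = τ'.shift ⟨s, a⟩) :
    pathMeasure G σ τ s = pathMeasure G σ' τ' s := by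
  rw [pathMeasure_eq_sum, pathMeasure_eq_sum, h0]
  simp only [hσ, hτ]

end

/-! ### Switching strategies at the first visit to a set -/

/-- A history (including the current state) avoids `D`. -/
def Avoids (D : Set S) (h : List (Step S L)) (s : S) : Prop := (∀ x ∈ h, x.state ∉ D) ∧ s ∉ D

theorem avoids_cons {D : Set S} {x : Step S L} {h : List (Step S L)} {s : S} :
    Avoids D (x :: h) s ↔ x.state ∉ D ∧ Avoids D h s := by
  simp [Avoids, and_assoc]

open Classical in
/-- Play `σ` as long as `D` is not visited, and `ρ` afterwards. -/
noncomputable def Strategy.switch {p : Player} (D : Set S) (σ ρ : Strategy G p) : Strategy G p where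
  choice h s := if Avoids D h s then σ.choice h s else ρ.choice h s
  support_subset h s := by
    split_ifs
    · exact σ.support_subset h s
    · exact ρ.support_subset h s

theorem Strategy.ext_choice {p : Player} {σ ρ : Strategy G p}
    (h : ∀ l s, σ.choice l s = ρ.choice l s) : σ = ρ := by
  cases σ; cases ρ
  congr
  funext l s
  exact h l s

theorem Strategy.switch_self {p : Player} (D : Set S) (σ : Strategy G p) :
    Strategy.switch D σ σ = σ :=
  Strategy.ext_choice fun _ _ => ite_self _

theorem Strategy.switch_shift_of_mem {p : Player} {D : Set S} (σ ρ : Strategy G p) {x : Step S L}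
    (hx : x.state ∈ D) : (Strategy.switch D σ ρ).shift x = ρ.shift x :=
  Strategy.ext_choice fun _ _ => if_neg fun hav => (avoids_cons.1 hav).1 hx

open Classical in
theorem Strategy.switch_choice {p : Player} (D : Set S) (σ ρ : Strategy G p) (h : List (Step S L))
    (s : {s : S // G.owner s = p}) : (Strategy.switch D σ ρ).choice h s =
      if Avoids D h s then σ.choice h s else ρ.choice h s := rfl

/-- After the switch `ρ` still receives the whole history, including the part before `D`. The
hypothesis `hρ` says that it ignores the step `x`. -/
theorem Strategy.switch_shift_of_notMem {p : Player} {D : Set S} (σ ρ : Strategy G p)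
    {x : Step S L} (hx : x.state ∉ D) (hρ : ρ.shift x = ρ) :
    (Strategy.switch D σ ρ).shift x = Strategy.switch D (σ.shift x) ρ := by
  refine Strategy.ext_choice fun h s => ?_
  have hρ' : ρ.choice (x :: h) s = ρ.choice h s := congrFun (congrFun (congrArg choice hρ) h) s
  have hl : ((Strategy.switch D σ ρ).shift x).choice h s =
      (Strategy.switch D σ ρ).choice (x :: h) s := rfl
  have hr : (σ.shift x).choice h s = σ.choice (x :: h) s := rfl
  have hav : Avoids D (x :: h) s ↔ Avoids D h s := avoids_cons.trans (and_iff_right hx)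
  rw [hl, Strategy.switch_choice, Strategy.switch_choice, hρ', hr]
  by_cases h' : Avoids D h s
  · rw [if_pos h', if_pos (hav.2 h')]
  · rw [if_neg h', if_neg (mt hav.1 h')]

theorem actionDist_switch_of_mem {D : Set S} (σ σ' : Strategy G Player.max)
    (τ τ' : Strategy G Player.min) {s : S} (hs : s ∈ D) :
    actionDist G (σ.switch D σ') (τ.switch D τ') [] s = actionDist G σ' τ' [] s := by
  unfold actionDist
  split <;> exact if_neg fun h => h.2 hs

theorem actionDist_switch_of_notMem {D : Set S} (σ σ' : Strategy G Player.max)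
    (τ τ' : Strategy G Player.min) {s : S} (hs : s ∉ D) :
    actionDist G (σ.switch D σ') (τ.switch D τ') [] s = actionDist G σ τ [] s := by
  unfold actionDist
  split <;> exact if_pos ⟨by simp, hs⟩

section

variable [Fintype S] [Fintype L]

theorem expectStep_switch_of_notMem {D : Set S} (σ σ' : Strategy G Player.max)
    (τ τ' : Strategy G Player.min) {s : S} (hs : s ∉ D) (f : L → S → ℝ) :
    expectStep (σ.switch D σ') (τ.switch D τ') s f = expectStep σ τ s f := by
  unfold expectStep
  rw [actionDist_switch_of_notMem σ σ' τ τ' hs]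

theorem quantReachReal_of_mem (σ : Strategy G Player.max) (τ : Strategy G Player.min) {D : Set S}
    (q : D → unitInterval) {s : S} (hs : s ∈ D) :
    quantReachReal G σ τ s D q = q ⟨s, hs⟩ := by
  classical
  unfold quantReachReal
  rw [Finset.sum_eq_single ⟨s, hs⟩]
  · rw [prob_untilProp_of_mem σ τ (Set.singleton_subset_iff.2 hs) hs,
      if_pos (Set.mem_singleton s), one_mul]
  · intro t _ ht
    rw [prob_untilProp_of_mem σ τ (Set.singleton_subset_iff.2 t.2) hs, if_neg, zero_mul]
    exact fun h => ht (Subtype.ext h.symm)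
  · simp

open Classical in
theorem quantReachReal_of_notMem (σ : Strategy G Player.max) (τ : Strategy G Player.min)
    {D : Set S} (q : D → unitInterval) {s : S} (hs : s ∉ D) :
    quantReachReal G σ τ s D q = expectStep σ τ s fun a s' =>
      quantReachReal G (σ.shift ⟨s, a⟩) (τ.shift ⟨s, a⟩) s' D q := by
  unfold quantReachReal
  rw [expectStep_sum]
  refine Finset.sum_congr rfl fun t _ => ?_
  rw [prob_untilProp_of_notMem σ τ (Set.singleton_subset_iff.2 t.2) hs, mul_comm,
    ← expectStep_mul_left]
  simp only [mul_comm]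

/-- If both players switch to `σ'` and `τ'` at the first visit to `D`, and these strategies do not
depend on the history before `D`, then the probability of visiting `T ⊆ D` is the expectation over
the first visited state of `D` of the probability under `σ'` and `τ'`. -/
theorem prob_reach_switch {D T : Set S} (hTD : T ⊆ D) {σ' : Strategy G Player.max}
    {τ' : Strategy G Player.min} (hσ' : ∀ x : Step S L, x.state ∉ D → σ'.shift x = σ')
    (hτ' : ∀ x : Step S L, x.state ∉ D → τ'.shift x = τ') (q : D → unitInterval)
    (hq : ∀ t : D, q t = prob G σ' τ' t (reach T)) (σ : Strategy G Player.max)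
    (τ : Strategy G Player.min) (s : S) :
    (prob G (σ.switch D σ') (τ.switch D τ') s (reach T) : ℝ) = quantReachReal G σ τ s D q := by
  classical
  have hmem : ∀ (σ : Strategy G Player.max) (τ : Strategy G Player.min) (s : S), s ∈ D →
      (prob G (σ.switch D σ') (τ.switch D τ') s (reach T) : ℝ) = quantReachReal G σ τ s D q := by
    intro σ τ s hs
    rw [quantReachReal_of_mem σ τ q hs, hq]
    have hμ : pathMeasure G (σ.switch D σ') (τ.switch D τ') s = pathMeasure G σ' τ' s :=
      pathMeasure_congr (actionDist_switch_of_mem _ _ _ _ hs)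
        (fun a => Strategy.switch_shift_of_mem _ _ hs)
        (fun a => Strategy.switch_shift_of_mem _ _ hs)
    simp only [prob, hμ]
  -- Outside `D` both sides satisfy the same one-step recursion, but its solution need not be
  -- unique. Each inequality is therefore proved for finite-time truncations of the smaller side,
  -- which start at 0.
  have hle : ∀ (n : ℕ) (σ : Strategy G Player.max) (τ : Strategy G Player.min) (s : S),
      hitBefore (σ.switch D σ') (τ.switch D τ') T T s n ≤ quantReachReal G σ τ s D q := by
    intro n
    induction n with
    | zero =>
      intro σ τ s
      simpa [hitBefore] using (quantReachReal_mem G σ τ s D q).1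
    | succ n ih =>
      intro σ τ s
      by_cases hs : s ∈ D
      · rw [← hmem σ τ s hs, reach_eq_untilProp]
        exact hitBefore_le _ _ subset_rfl _ _
      · rw [hitBefore_succ_of_notMem _ _ subset_rfl (fun h => hs (hTD h)),
          quantReachReal_of_notMem σ τ q hs, expectStep_switch_of_notMem _ _ _ _ hs]
        refine expectStep_mono _ _ _ fun a s' => ?_
        rw [Strategy.switch_shift_of_notMem _ _ hs (hσ' ⟨s, a⟩ hs),
          Strategy.switch_shift_of_notMem _ _ hs (hτ' ⟨s, a⟩ hs)]
        exact ih _ _ _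
  -- The converse truncates the first visit to `D` instead of the visit to `T`.
  have hge : ∀ (n : ℕ) (σ : Strategy G Player.max) (τ : Strategy G Player.min) (s : S),
      ∑ t : D, hitBefore σ τ D {(t : S)} s n * (q t : ℝ) ≤
        prob G (σ.switch D σ') (τ.switch D τ') s (reach T) := by
    intro n
    induction n with
    | zero =>
      intro σ τ s
      simpa [hitBefore] using (prob _ _ _ _ _).2.1
    | succ n ih =>
      intro σ τ s
      by_cases hs : s ∈ D
      · rw [hmem σ τ s hs]
        exact Finset.sum_le_sum fun t _ => mul_le_mul_of_nonneg_right
          (hitBefore_le _ _ (Set.singleton_subset_iff.2 t.2) _ _) (q t).2.1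
      · rw [reach_eq_untilProp, prob_untilProp_of_notMem _ _ subset_rfl (fun h => hs (hTD h)),
          expectStep_switch_of_notMem _ _ _ _ hs]
        have hsum : ∑ t : D, hitBefore σ τ D {(t : S)} s (n + 1) * (q t : ℝ) =
            expectStep σ τ s fun a s' => ∑ t : D,
              hitBefore (σ.shift ⟨s, a⟩) (τ.shift ⟨s, a⟩) D {(t : S)} s' n * (q t : ℝ) := by
          rw [expectStep_sum]
          refine Finset.sum_congr rfl fun t _ => ?_
          rw [hitBefore_succ_of_notMem σ τ (Set.singleton_subset_iff.2 t.2) hs, mul_comm,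
            ← expectStep_mul_left]
          simp only [mul_comm]
        rw [hsum]
        refine expectStep_mono _ _ _ fun a s' => ?_
        rw [Strategy.switch_shift_of_notMem _ _ hs (hσ' ⟨s, a⟩ hs),
          Strategy.switch_shift_of_notMem _ _ hs (hτ' ⟨s, a⟩ hs), ← reach_eq_untilProp]
        exact ih _ _ _
  refine le_antisymm ?_ ?_
  · rw [reach_eq_untilProp]
    exact le_of_tendsto' (tendsto_hitBefore _ _ subset_rfl s) fun n => hle n σ τ s
  · refine le_of_tendsto' (x := atTop) (tendsto_finsetSum _ fun t _ => ?_) fun n => hge n σ τ s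
    exact (tendsto_hitBefore σ τ (Set.singleton_subset_iff.2 t.2) s).mul_const _

end

end Hitting

/-! ### Discounted games with the set of visited targets as memory -/

section Discounted

variable {S L ι : Type*} {G : StochasticGame S L}

/-! ### Discounted hitting probabilities -/

section DiscHit

variable [Fintype S] [Fintype L]

/-- The expectation of `β ^ t`, where `t` is the time of the first visit to `T`. -/
noncomputable def discReach (β : ℝ) (σ : Strategy G Player.max) (τ : Strategy G Player.min)
    (T : Set S) (s : S) : ℝ :=
  ∑' n, hitProb σ τ T T s n * β ^ n

/-- Abel's limit theorem: the coefficients of the power series in β sum to the reachability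
probability. -/
theorem tendsto_discReach (σ : Strategy G Player.max) (τ : Strategy G Player.min) (T : Set S)
    (s : S) : Tendsto (fun β => discReach β σ τ T s) (𝓝[<] 1) (𝓝 (prob G σ τ s (reach T) : ℝ)) := by
  rw [reach_eq_untilProp]
  exact Real.tendsto_tsum_powerSeries_nhdsWithin_lt (tendsto_hitBefore σ τ subset_rfl s)

theorem summable_discReach {β : ℝ} (h0 : 0 ≤ β) (h1 : β ≤ 1) (σ : Strategy G Player.max)
    (τ : Strategy G Player.min) (T : Set S) (s : S) :
    Summable fun n => hitProb σ τ T T s n * β ^ n :=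
  Summable.of_nonneg_of_le (fun _ => mul_nonneg (hitProb_nonneg _ _ _ _ _ _) (pow_nonneg h0 _))
    (fun _ => mul_le_of_le_one_right (hitProb_nonneg _ _ _ _ _ _) (pow_le_one₀ h0 h1))
    (hasSum_hitProb σ τ subset_rfl s).summable

theorem discReach_nonneg {β : ℝ} (h0 : 0 ≤ β) (σ : Strategy G Player.max)
    (τ : Strategy G Player.min) (T : Set S) (s : S) : 0 ≤ discReach β σ τ T s :=
  tsum_nonneg fun n => mul_nonneg (hitProb_nonneg _ _ _ _ _ _) (pow_nonneg h0 n)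

theorem discReach_le_one {β : ℝ} (h0 : 0 ≤ β) (h1 : β ≤ 1) (σ : Strategy G Player.max)
    (τ : Strategy G Player.min) (T : Set S) (s : S) : discReach β σ τ T s ≤ 1 := by
  have hs := hasSum_hitProb σ τ (subset_refl T) s
  refine le_trans ((summable_discReach h0 h1 σ τ T s).tsum_le_tsum (fun n => ?_) hs.summable) ?_
  · exact mul_le_of_le_one_right (hitProb_nonneg _ _ _ _ _ _) (pow_le_one₀ h0 h1)
  · rw [hs.tsum_eq]
    exact (prob _ _ _ _ _).2.2

theorem discReach_of_mem (β : ℝ) (σ : Strategy G Player.max) (τ : Strategy G Player.min)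
    {T : Set S} {s : S} (hs : s ∈ T) : discReach β σ τ T s = 1 := by
  classical
  unfold discReach
  rw [tsum_eq_single 0]
  · rw [hitProb_zero, if_pos hs, pow_zero, one_mul]
  · intro n hn
    obtain ⟨n, rfl⟩ := Nat.exists_eq_succ_of_ne_zero hn
    rw [hitProb_succ_of_mem σ τ T hs n, zero_mul]

theorem discReach_of_notMem {β : ℝ} (h0 : 0 ≤ β) (h1 : β ≤ 1) (σ : Strategy G Player.max)
    (τ : Strategy G Player.min) {T : Set S} {s : S} (hs : s ∉ T) :
    discReach β σ τ T s = β * expectStep σ τ s fun a s' =>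
      discReach β (σ.shift ⟨s, a⟩) (τ.shift ⟨s, a⟩) T s' := by
  classical
  have h := (hasSum_nat_add_iff' 1).2 (summable_discReach h0 h1 σ τ T s).hasSum
  simp only [hitProb_succ_of_notMem σ τ T hs, Finset.sum_range_one, hitProb_zero, if_neg hs,
    zero_mul, sub_zero] at h
  have hterm : ∀ n, (expectStep σ τ s fun a s' =>
      hitProb (σ.shift ⟨s, a⟩) (τ.shift ⟨s, a⟩) T T s' n) * β ^ (n + 1) =
      β * expectStep σ τ s fun a s' =>
        hitProb (σ.shift ⟨s, a⟩) (τ.shift ⟨s, a⟩) T T s' n * β ^ n := by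
    intro n
    simp only [mul_comm (hitProb _ _ _ _ _ n) (β ^ n), expectStep_mul_left]
    ring
  simp only [hterm] at h
  have h' := (hasSum_expectStep σ τ s fun a s' =>
    (summable_discReach h0 h1 (σ.shift ⟨s, a⟩) (τ.shift ⟨s, a⟩) T s').hasSum).mul_left β
  exact h.unique h'

end DiscHit

/-- The objectives whose target set is visited by a history. -/
def historyVisited (Ω : ι → Objective S) (h : List (Step S L)) : Set ι :=
  {i | ∃ x ∈ h, x.state ∈ (Ω i).target}

/-- The strategy that selects an action as a function of the current state and of the set of
objectives whose target set has been visited, where those in `I` count as visited initially. -/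
noncomputable def memStrategy (Ω : ι → Objective S) (m : (s : S) → Set ι → G.Act s) (p : Player)
    (I : Set ι) : Strategy G p where
  choice h s := PMF.pure (m s (I ∪ historyVisited Ω h ∪ visited Ω (s : S)) : L)
  support_subset h s := by
    rw [PMF.support_pure, Set.singleton_subset_iff]
    exact (m _ _).2

/-- The class of memory strategies is closed under residuals: a step only updates the initial
memory. -/
theorem memStrategy_shift (Ω : ι → Objective S) (m : (s : S) → Set ι → G.Act s) (p : Player)
    (I : Set ι) (x : Step S L) :
    (memStrategy Ω m p I).shift x = memStrategy Ω m p (I ∪ visited Ω x.state) := by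
  refine Strategy.ext_choice fun h s => ?_
  have : historyVisited Ω (x :: h) = visited Ω x.state ∪ historyVisited Ω h := by
    ext i
    simp [historyVisited, visited]
  change PMF.pure _ = PMF.pure _
  rw [this, ← Set.union_assoc]

theorem actionDist_eq_max (σ : Strategy G Player.max) (τ : Strategy G Player.min)
    (h : List (Step S L)) {s : S} (hs : G.owner s = Player.max) :
    actionDist G σ τ h s = σ.choice h ⟨s, hs⟩ := by
  unfold actionDist
  split
  · rfl
  · next h' => exact absurd (hs.symm.trans h') (by simp)

theorem actionDist_eq_min (σ : Strategy G Player.max) (τ : Strategy G Player.min)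
    (h : List (Step S L)) {s : S} (hs : G.owner s = Player.min) :
    actionDist G σ τ h s = τ.choice h ⟨s, hs⟩ := by
  unfold actionDist
  split
  · next h' => exact absurd (hs.symm.trans h') (by simp)
  · rfl

theorem actionDist_support_subset (σ : Strategy G Player.max) (τ : Strategy G Player.min)
    (h : List (Step S L)) (s : S) : (actionDist G σ τ h s).support ⊆ G.Act s := by
  unfold actionDist
  split
  · exact σ.support_subset _ _
  · exact τ.support_subset _ _

/-! ### Rewards and discounted payoffs -/

section VisitReward

variable [Fintype ι]

open Classical in
/-- The reward for visiting the target sets of new objectives in `s`. -/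
noncomputable def visitReward (Ω : ι → Objective S) (g : ι → ℝ) (s : S) (I : Set ι) : ℝ :=
  ∑ i, if i ∈ visited Ω s \ I then g i else 0

theorem visitReward_neg (Ω : ι → Objective S) (g : ι → ℝ) (s : S) (I : Set ι) :
    visitReward Ω (-g) s I = -visitReward Ω g s I := by
  unfold visitReward
  rw [← Finset.sum_neg_distrib]
  refine Finset.sum_congr rfl fun i _ => ?_
  split_ifs <;> simp

end VisitReward

section Payoff

variable [Fintype S] [Fintype L] [Fintype ι]

open Classical in
/-- The expectation of the discounted sum of the rewards `g i`, each received at the first visit to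
the target set of objective `i ∉ I`. -/
noncomputable def discPayoff (Ω : ι → Objective S) (g : ι → ℝ) (β : ℝ) (I : Set ι)
    (σ : Strategy G Player.max) (τ : Strategy G Player.min) (s : S) : ℝ :=
  ∑ i, if i ∈ I then 0 else g i * discReach β σ τ (Ω i).target s

/-- An objective whose target contains `s` pays in full now and enters the memory, so it contributes
nothing later. The pair (state, memory) thus makes first-visit rewards Markovian. -/
theorem discPayoff_eq (Ω : ι → Objective S) (g : ι → ℝ) {β : ℝ} (h0 : 0 ≤ β) (h1 : β ≤ 1)
    (I : Set ι) (σ : Strategy G Player.max) (τ : Strategy G Player.min) (s : S) :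
    discPayoff Ω g β I σ τ s = visitReward Ω g s I + β * expectStep σ τ s fun a s' =>
      discPayoff Ω g β (I ∪ visited Ω s) (σ.shift ⟨s, a⟩) (τ.shift ⟨s, a⟩) s' := by
  classical
  unfold discPayoff visitReward
  rw [expectStep_sum, Finset.mul_sum, ← Finset.sum_add_distrib]
  refine Finset.sum_congr rfl fun i _ => ?_
  by_cases hI : i ∈ I
  · simp [hI, expectStep_zero]
  · by_cases hs : s ∈ (Ω i).target
    · simp [hI, hs, visited, expectStep_zero, discReach_of_mem]
    · simp only [hI, hs, visited, Set.mem_union, Set.mem_ofPred_eq, Set.mem_sdiff, or_self, if_false,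
        false_and, zero_add]
      rw [discReach_of_notMem h0 h1 σ τ hs, expectStep_mul_left]
      ring

theorem neg_sum_abs_le_discPayoff (Ω : ι → Objective S) (g : ι → ℝ) {β : ℝ} (h0 : 0 ≤ β)
    (h1 : β ≤ 1) (I : Set ι) (σ : Strategy G Player.max) (τ : Strategy G Player.min) (s : S) :
    -∑ i, |g i| ≤ discPayoff Ω g β I σ τ s := by
  classical
  unfold discPayoff
  rw [← Finset.sum_neg_distrib]
  refine Finset.sum_le_sum fun i _ => ?_
  have hk0 := discReach_nonneg h0 σ τ (Ω i).target s
  have hk1 := discReach_le_one h0 h1 σ τ (Ω i).target s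
  split_ifs
  · simp
  · have := neg_abs_le (g i * discReach β σ τ (Ω i).target s)
    rw [abs_mul, abs_of_nonneg hk0] at this
    nlinarith [abs_nonneg (g i)]

theorem discPayoff_neg (Ω : ι → Objective S) (g : ι → ℝ) (β : ℝ) (I : Set ι)
    (σ : Strategy G Player.max) (τ : Strategy G Player.min) (s : S) :
    discPayoff Ω (-g) β I σ τ s = -discPayoff Ω g β I σ τ s := by
  unfold discPayoff
  rw [← Finset.sum_neg_distrib]
  refine Finset.sum_congr rfl fun i _ => ?_
  split_ifs <;> simp

/-- A function that satisfies the optimality inequality along all plays of a class of strategy pairs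
is a lower bound for the discounted payoff of these pairs. -/
theorem le_discPayoff (Ω : ι → Objective S) (g : ι → ℝ) {β : ℝ} (h0 : 0 ≤ β) (h1 : β < 1)
    (v : S → Set ι → ℝ) (C : Set ι → Strategy G Player.max → Strategy G Player.min → Prop)
    (hC : ∀ I σ τ, C I σ τ → ∀ x : Step S L, C (I ∪ visited Ω x.state) (σ.shift x) (τ.shift x))
    (hv : ∀ I σ τ, C I σ τ → ∀ s, v s I ≤ visitReward Ω g s I +
      β * expectStep σ τ s fun _ s' => v s' (I ∪ visited Ω s))
    {I : Set ι} {σ : Strategy G Player.max} {τ : Strategy G Player.min} (h : C I σ τ) (s : S) :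
    v s I ≤ discPayoff Ω g β I σ τ s := by
  obtain ⟨M, hM⟩ := (Set.finite_range fun x : S × Set ι => v x.1 x.2).bddAbove
  have hM' : ∀ s I, v s I ≤ M := fun s I => hM ⟨(s, I), rfl⟩
  -- Unfolding the inequality `n` times leaves a discounted error. Its constant comes from the crude
  -- bounds `v ≤ M` and payoff at least `-∑ |g i|`.
  have key : ∀ n : ℕ, ∀ I σ τ, C I σ τ → ∀ s,
      v s I ≤ discPayoff Ω g β I σ τ s + β ^ n * (M + ∑ i, |g i|) := by
    intro n
    induction n with
    | zero =>
      intro I σ τ _ s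
      have := neg_sum_abs_le_discPayoff Ω g h0 h1.le I σ τ s
      have := hM' s I
      rw [pow_zero, one_mul]
      linarith
    | succ n ih =>
      intro I σ τ h s
      have hle := expectStep_mono σ τ s fun a s' => ih _ _ _ (hC I σ τ h ⟨s, a⟩) s'
      rw [expectStep_add, expectStep_const] at hle
      have hle' := mul_le_mul_of_nonneg_left hle h0
      have := hv I σ τ h s
      rw [discPayoff_eq Ω g h0 h1.le, pow_succ]
      linarith
  have hlim : Tendsto (fun n : ℕ => discPayoff Ω g β I σ τ s + β ^ n * (M + ∑ i, |g i|)) atTop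
      (𝓝 (discPayoff Ω g β I σ τ s + 0 * (M + ∑ i, |g i|))) :=
    ((tendsto_pow_atTop_nhds_zero_of_lt_one h0 h1).mul_const _).const_add _
  rw [zero_mul, add_zero] at hlim
  exact ge_of_tendsto' hlim fun n => key n I σ τ h s

end Payoff

/-! ### The optimality equation -/

section BestAction

variable [Finite L]

theorem exists_bestAction (G : StochasticGame S L) (s : S) (f : L → ℝ) :
    ∃ a ∈ G.Act s, (G.owner s = Player.max → ∀ b ∈ G.Act s, f b ≤ f a) ∧
      (G.owner s = Player.min → ∀ b ∈ G.Act s, f a ≤ f b) := by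
  cases G.owner s with
  | max =>
    obtain ⟨a, ha, h⟩ := Set.exists_max_image (G.Act s) f (Set.toFinite _) (G.act_nonempty s)
    exact ⟨a, ha, fun _ => h, fun h' => nomatch h'⟩
  | min =>
    obtain ⟨a, ha, h⟩ := Set.exists_min_image (G.Act s) f (Set.toFinite _) (G.act_nonempty s)
    exact ⟨a, ha, fun h' => (nomatch h'), fun _ => h⟩

/-- An action that is optimal for the owner of `s` with respect to the payoff `f`. -/
noncomputable def bestAction (G : StochasticGame S L) (s : S) (f : L → ℝ) : G.Act s :=
  ⟨(exists_bestAction G s f).choose, (exists_bestAction G s f).choose_spec.1⟩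

theorem le_bestAction {s : S} (hs : G.owner s = Player.max) (f : L → ℝ) {b : L}
    (hb : b ∈ G.Act s) : f b ≤ f (bestAction G s f) :=
  (exists_bestAction G s f).choose_spec.2.1 hs b hb

theorem bestAction_le {s : S} (hs : G.owner s = Player.min) (f : L → ℝ) {b : L}
    (hb : b ∈ G.Act s) : f (bestAction G s f) ≤ f b :=
  (exists_bestAction G s f).choose_spec.2.2 hs b hb

/-- Maxima and minima over actions are nonexpansive in the sup norm, whoever owns the state. -/
theorem bestAction_le_add (s : S) {f f' : L → ℝ} {δ : ℝ} (h : ∀ a, f a ≤ f' a + δ) :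
    f (bestAction G s f) ≤ f' (bestAction G s f') + δ := by
  cases hs : G.owner s with
  | max =>
    exact (h _).trans (add_le_add_left (le_bestAction hs f' (bestAction G s f).2) δ)
  | min =>
    exact (bestAction_le hs f (bestAction G s f').2).trans (h _)

theorem abs_bestAction_sub_le (s : S) {f f' : L → ℝ} {δ : ℝ} (h : ∀ a, |f a - f' a| ≤ δ) :
    |f (bestAction G s f) - f' (bestAction G s f')| ≤ δ := by
  rw [abs_sub_le_iff]
  constructor
  · have := bestAction_le_add (G := G) s (f := f) (f' := f') (δ := δ) fun a => by
      linarith [(abs_sub_le_iff.1 (h a)).1]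
    linarith
  · have := bestAction_le_add (G := G) s (f := f') (f' := f) (δ := δ) fun a => by
      linarith [(abs_sub_le_iff.1 (h a)).2]
    linarith

end BestAction

section SuccMean

variable [Fintype S]

/-- The expectation of `v` at the successor state, for every action. -/
noncomputable def succMean (G : StochasticGame S L) (s : S) (v : S → ℝ) (a : L) : ℝ :=
  ∑ s' : S, (G.P s a s').toReal * v s'

theorem abs_succMean_sub_le (s : S) {v w : S → ℝ} {δ : ℝ} (h : ∀ s', |v s' - w s'| ≤ δ) (a : L) :
    |succMean G s v a - succMean G s w a| ≤ δ := by
  unfold succMean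
  rw [← Finset.sum_sub_distrib]
  calc |∑ s' : S, ((G.P s a s').toReal * v s' - (G.P s a s').toReal * w s')|
      ≤ ∑ s' : S, |(G.P s a s').toReal * v s' - (G.P s a s').toReal * w s'| :=
        Finset.abs_sum_le_sum_abs _ _
    _ ≤ ∑ s' : S, (G.P s a s').toReal * δ := by
        refine Finset.sum_le_sum fun s' _ => ?_
        rw [← mul_sub, abs_mul, abs_of_nonneg ENNReal.toReal_nonneg]
        exact mul_le_mul_of_nonneg_left (h s') ENNReal.toReal_nonneg
    _ = δ := by rw [← Finset.sum_mul, sum_pmf_toReal, one_mul]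

theorem succMean_neg (s : S) (v : S → ℝ) (a : L) :
    succMean G s (fun s' => -v s') a = -succMean G s v a := by
  simp [succMean]

end SuccMean

/-- Pigeonhole: if each of the finitely many `m` failed eventually, all would fail simultaneously.
-/
theorem exists_frequently_of_eventually_exists {X M : Type*} [Finite M] {l : Filter X} [l.NeBot]
    {p : X → M → Prop} (h : ∀ᶠ x in l, ∃ m, p x m) : ∃ m, ∃ᶠ x in l, p x m := by
  by_contra! hcon
  obtain ⟨x, ⟨m, hm⟩, hx⟩ := (h.and (eventually_all.2 hcon)).exists
  exact hx m hm

/-! ### Saddle points of weighted games -/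

section Bellman

variable [Fintype S] [Fintype L]

theorem expectStep_eq_sum_succMean (σ : Strategy G Player.max) (τ : Strategy G Player.min) (s : S)
    (v : S → ℝ) : expectStep σ τ s (fun _ s' => v s') =
      ∑ a : L, (actionDist G σ τ [] s a).toReal * succMean G s v a := rfl

/-- Averaging over successors and choosing a best action are nonexpansive, so the factor β makes the
Shapley operator a contraction. -/
theorem exists_bellman_solution [Fintype ι] (G : StochasticGame S L) (Ω : ι → Objective S)
    (g : ι → ℝ) {β : ℝ} (h0 : 0 ≤ β) (h1 : β < 1) :
    ∃ v : S → Set ι → ℝ, ∀ s I, v s I = visitReward Ω g s I +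
      β * succMean G s (fun s' => v s' (I ∪ visited Ω s))
        (bestAction G s (succMean G s fun s' => v s' (I ∪ visited Ω s))) := by
  classical
  let F : (S × Set ι → ℝ) → (S × Set ι → ℝ) := fun v x => visitReward Ω g x.1 x.2 +
    β * succMean G x.1 (fun s' => v (s', x.2 ∪ visited Ω x.1))
      (bestAction G x.1 (succMean G x.1 fun s' => v (s', x.2 ∪ visited Ω x.1)))
  have hF : ContractingWith ⟨β, h0⟩ F := by
    refine ⟨h1, LipschitzWith.of_dist_le_mul fun v w => ?_⟩
    refine (dist_pi_le_iff (by positivity)).2 fun x => ?_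
    rw [Real.dist_eq, add_sub_add_left_eq_sub, ← mul_sub, abs_mul, abs_of_nonneg h0]
    refine mul_le_mul_of_nonneg_left (abs_bestAction_sub_le _ fun a => ?_) h0
    refine abs_succMean_sub_le _ (fun s' => ?_) a
    rw [← Real.dist_eq]
    exact dist_le_pi_dist v w _
  refine ⟨fun s I => ContractingWith.fixedPoint F hF (s, I), fun s I => ?_⟩
  exact (congrFun hF.fixedPoint_isFixedPt (s, I)).symm

theorem expectStep_of_pure {σ : Strategy G Player.max} {τ : Strategy G Player.min} {s : S}
    {b : L} (h : actionDist G σ τ [] s = PMF.pure b) (v : S → ℝ) :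
    expectStep σ τ s (fun _ s' => v s') = succMean G s v b := by
  classical
  rw [expectStep_eq_sum_succMean, h, Finset.sum_eq_single b]
  · simp
  · intro a _ ha
    simp [ha]
  · simp

theorem le_expectStep {σ : Strategy G Player.max} {τ : Strategy G Player.min} {s : S} {c : ℝ}
    {v : S → ℝ} (h : ∀ a ∈ G.Act s, c ≤ succMean G s v a) :
    c ≤ expectStep σ τ s fun _ s' => v s' := by
  rw [expectStep_eq_sum_succMean]
  calc c = ∑ a : L, (actionDist G σ τ [] s a).toReal * c := by
        rw [← Finset.sum_mul, sum_pmf_toReal, one_mul]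
    _ ≤ _ := by
      refine Finset.sum_le_sum fun a _ => ?_
      by_cases ha : a ∈ (actionDist G σ τ [] s).support
      · exact mul_le_mul_of_nonneg_left (h a (actionDist_support_subset _ _ _ _ ha))
          ENNReal.toReal_nonneg
      · rw [PMF.mem_support_iff, not_not] at ha
        simp [ha]

/-- The fixed point `v s ∅` separates the two sides: best actions guarantee it to either player
against an arbitrary opponent. -/
theorem exists_discounted_saddle [Fintype ι] (G : StochasticGame S L) (Ω : ι → Objective S)
    (g : ι → ℝ) {β : ℝ} (h0 : 0 ≤ β) (h1 : β < 1) :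
    ∃ m : (s : S) → Set ι → G.Act s, ∀ s (σ : Strategy G Player.max) (τ : Strategy G Player.min),
      discPayoff Ω g β ∅ σ (memStrategy Ω m Player.min ∅) s ≤
        discPayoff Ω g β ∅ (memStrategy Ω m Player.max ∅) τ s := by
  obtain ⟨v, hv⟩ := exists_bellman_solution G Ω g h0 h1
  let m : (s : S) → Set ι → G.Act s := fun s J => bestAction G s (succMean G s fun s' => v s' J)
  have hpure : ∀ p (I : Set ι) (s : {s // G.owner s = p}), (memStrategy Ω m p I).choice [] s =
      PMF.pure (bestAction G s (succMean G s fun s' => v s' (I ∪ visited Ω (s : S))) : L) := by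
    intro p I s
    change PMF.pure _ = PMF.pure _
    simp [m, historyVisited]
  refine ⟨m, fun s σ τ => le_trans (b := v s ∅) ?_ ?_⟩
  -- Min's half is a lower bound for the game with rewards `-g`, with `-v` as the test function.
  · rw [← neg_le_neg_iff, ← discPayoff_neg]
    refine le_discPayoff Ω (-g) h0 h1 (fun s I => -v s I)
      (fun I _ τ => τ = memStrategy Ω m Player.min I) ?_ ?_ rfl s
    · rintro I σ τ rfl x
      exact memStrategy_shift Ω m _ I x
    · rintro I σ τ rfl s
      rw [hv, visitReward_neg, neg_add, ← mul_neg, ← succMean_neg]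
      refine add_le_add_right (mul_le_mul_of_nonneg_left ?_ h0) _
      cases hs : G.owner s with
      | min =>
        rw [expectStep_of_pure ((actionDist_eq_min _ _ _ hs).trans (hpure _ I ⟨s, hs⟩))
          fun s' => -v s' (I ∪ visited Ω s)]
      | max =>
        refine le_expectStep fun a ha => ?_
        rw [succMean_neg, succMean_neg, neg_le_neg_iff]
        exact le_bestAction hs _ ha
  · refine le_discPayoff Ω g h0 h1 v (fun I σ _ => σ = memStrategy Ω m Player.max I) ?_ ?_ rfl s
    · rintro I σ τ rfl x
      exact memStrategy_shift Ω m _ I x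
    · rintro I σ τ rfl s
      rw [hv]
      refine add_le_add_right (mul_le_mul_of_nonneg_left ?_ h0) _
      cases hs : G.owner s with
      | max =>
        rw [expectStep_of_pure ((actionDist_eq_max _ _ _ hs).trans (hpure _ I ⟨s, hs⟩))
          fun s' => v s' (I ∪ visited Ω s)]
      | min =>
        exact le_expectStep fun a ha => bestAction_le hs _ ha

/-- One of the finitely many selectors is a saddle point for discount factors arbitrarily close to
1; the inequality passes to the limit. -/
theorem exists_weighted_saddle [Fintype ι] (G : StochasticGame S L) (Ω : ι → Objective S)
    (g : ι → ℝ) :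
    ∃ m : (s : S) → Set ι → G.Act s, ∀ s (σ : Strategy G Player.max) (τ : Strategy G Player.min),
      ∑ i, g i * (prob G σ (memStrategy Ω m Player.min ∅) s (reach (Ω i).target) : ℝ) ≤
        ∑ i, g i * (prob G (memStrategy Ω m Player.max ∅) τ s (reach (Ω i).target) : ℝ) := by
  have hev : ∀ᶠ β : ℝ in 𝓝[<] 1, ∃ m : (s : S) → Set ι → G.Act s,
      ∀ s (σ : Strategy G Player.max) (τ : Strategy G Player.min),
        discPayoff Ω g β ∅ σ (memStrategy Ω m Player.min ∅) s ≤
          discPayoff Ω g β ∅ (memStrategy Ω m Player.max ∅) τ s := by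
    filter_upwards [Ico_mem_nhdsLT (zero_lt_one' ℝ)] with β hβ
    exact exists_discounted_saddle G Ω g hβ.1 hβ.2
  obtain ⟨m, hm⟩ := exists_frequently_of_eventually_exists hev
  refine ⟨m, fun s σ τ => ?_⟩
  have hlim : ∀ (σ : Strategy G Player.max) (τ : Strategy G Player.min),
      Tendsto (fun β => discPayoff Ω g β ∅ σ τ s) (𝓝[<] 1)
        (𝓝 (∑ i, g i * (prob G σ τ s (reach (Ω i).target) : ℝ))) := by
    intro σ τ
    simp only [discPayoff, Set.mem_empty_iff_false, if_false]
    exact tendsto_finsetSum _ fun i _ => (tendsto_discReach σ τ _ s).const_mul _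
  exact le_of_tendsto_of_tendsto_of_frequently (hlim _ _) (hlim _ _) (hm.mono fun β h => h s σ τ)

end Bellman

end Discounted

/-! ### Lexicographic saddle points -/

section Saddle

variable {S L : Type*} {G : StochasticGame S L}

/-- If `x` exceeded `y`, the first differing coordinate would dominate the weighted difference for
all small ε > 0. -/
theorem lex_le_of_frequently {n : ℕ} {x y : Fin n → unitInterval}
    (h : ∃ᶠ ε : ℝ in 𝓝[>] 0, ∑ i : Fin n, ε ^ (i : ℕ) * (x i : ℝ) ≤
      ∑ i : Fin n, ε ^ (i : ℕ) * (y i : ℝ)) :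
    toLex x ≤ toLex y := by
  by_contra hlt
  obtain ⟨i, hi, hi'⟩ := not_le.1 hlt
  change ∀ j < i, y j = x j at hi
  change y i < x i at hi'
  refine h ?_
  -- The weighted difference divided by `ε ^ i`: terms before `i` cancel, and the remaining
  -- exponents are genuine differences. At 0 only the term `i` remains.
  let f : ℝ → ℝ := fun ε => ∑ j : Fin n, if j < i then 0 else
    ε ^ ((j : ℕ) - i) * ((x j : ℝ) - y j)
  have hf0 : f 0 = (x i : ℝ) - y i := by
    simp only [f]
    rw [Finset.sum_eq_single i]
    · simp
    · intro j _ hj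
      split_ifs with hji
      · rfl
      · have : (j : ℕ) - i ≠ 0 := by
          have := lt_of_le_of_ne (not_lt.1 hji) hj.symm
          have := Fin.lt_def.1 this
          omega
        rw [zero_pow this, zero_mul]
    · simp
  have hfc : Continuous f := by
    refine continuous_finsetSum _ fun j _ => ?_
    split_ifs
    · exact continuous_const
    · fun_prop
  have hpos : ∀ᶠ ε in 𝓝[>] (0 : ℝ), 0 < f ε := by
    refine nhdsWithin_le_nhds (hfc.continuousAt.eventually (lt_mem_nhds ?_))
    rw [hf0]
    exact sub_pos.2 hi'
  filter_upwards [hpos, self_mem_nhdsWithin] with ε hε hε0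
  have hε0' : (0 : ℝ) < ε := hε0
  rw [not_le, ← sub_pos, ← Finset.sum_sub_distrib]
  have hsum : ∑ j : Fin n, (ε ^ (j : ℕ) * (x j : ℝ) - ε ^ (j : ℕ) * (y j : ℝ)) =
      ε ^ (i : ℕ) * f ε := by
    simp only [f, Finset.mul_sum]
    refine Finset.sum_congr rfl fun j _ => ?_
    split_ifs with hji
    · rw [hi j hji, sub_self, mul_zero]
    · rw [← mul_assoc, ← pow_add, Nat.add_sub_cancel' (Fin.le_def.1 (not_lt.1 hji)), mul_sub]
  rw [hsum]
  positivity

theorem prob_property [Fintype S] [Fintype L] (σ : Strategy G Player.max)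
    (τ : Strategy G Player.min) (s : S) (Ω : Objective S) :
    prob G σ τ s Ω.property = match Ω.kind with
      | ObjKind.reach => prob G σ τ s (reach Ω.target)
      | ObjKind.safe => unitInterval.symm (prob G σ τ s (reach Ω.target)) := by
  unfold Objective.property
  cases Ω.kind with
  | reach => rfl
  | safe => exact Subtype.ext (prob_safe σ τ _ s)

/-- A single pair of memory strategies is optimal from all initial states. -/
theorem exists_lex_saddle [Fintype S] [Fintype L] (G : StochasticGame S L) {n : ℕ}
    (Ω : Fin n → Objective S) :
    ∃ m : (s : S) → Set (Fin n) → G.Act s,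
      ∀ s (σ : Strategy G Player.max) (τ : Strategy G Player.min),
        toLex (fun i => prob G σ (memStrategy Ω m Player.min ∅) s (Ω i).property) ≤
          toLex (fun i => prob G (memStrategy Ω m Player.max ∅) τ s (Ω i).property) := by
  -- Safety is 1 minus reachability, so each payoff is affine in a reachability probability. The
  -- offset is independent of the strategies and appears on both sides.
  let sgn : Fin n → ℝ := fun i => match (Ω i).kind with
    | ObjKind.reach => 1
    | ObjKind.safe => -1
  let off : Fin n → ℝ := fun i => match (Ω i).kind with
    | ObjKind.reach => 0
    | ObjKind.safe => 1
  have hprob : ∀ (σ : Strategy G Player.max) (τ : Strategy G Player.min) s i,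
      (prob G σ τ s (Ω i).property : ℝ) =
        off i + sgn i * (prob G σ τ s (reach (Ω i).target) : ℝ) := by
    intro σ τ s i
    rw [prob_property]
    simp only [off, sgn]
    cases (Ω i).kind with
    | reach => simp
    | safe => simp [unitInterval.coe_symm_eq, sub_eq_add_neg]
  obtain ⟨m, hm⟩ := exists_frequently_of_eventually_exists (l := 𝓝[>] (0 : ℝ))
    (Eventually.of_forall fun ε => exists_weighted_saddle G Ω fun i => ε ^ (i : ℕ) * sgn i)
  refine ⟨m, fun s σ τ => lex_le_of_frequently (hm.mono fun ε h => ?_)⟩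
  simp only [hprob, mul_add, Finset.sum_add_distrib, ← mul_assoc]
  exact add_le_add_right (h s σ τ) _

/-- The memory stays empty until a target is visited, so earlier history has no influence; this is
what `prob_reach_switch` requires. -/
theorem memStrategy_shift_of_notMem {ι : Type*} (Ω : ι → Objective S) (m : (s : S) → Set ι → G.Act s)
    (p : Player) {x : Step S L} (hx : x.state ∉ ⋃ j, (Ω j).target) :
    (memStrategy Ω m p ∅).shift x = memStrategy Ω m p ∅ := by
  rw [memStrategy_shift, Set.empty_union]
  congr 1
  refine Set.eq_empty_of_forall_notMem fun i hi => hx (Set.mem_iUnion.2 ⟨i, hi⟩)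

/-! ### From saddle points to lex-values -/

variable {ι : Type*} [Finite ι] [LinearOrder ι]

/-- The hypothesis at `τ = τ₀` bounds every infimum by `p σ₀ τ₀`; at `σ = σ₀` it shows that `σ₀`
guarantees this payoff. -/
theorem lexSupInf_eq_of_saddle (p : Strategy G Player.max → Strategy G Player.min → LexVec ι)
    (σ₀ : Strategy G Player.max) (τ₀ : Strategy G Player.min) (h : ∀ σ τ, p σ τ₀ ≤ p σ₀ τ) :
    lexSupInf p = p σ₀ τ₀ := by
  refine le_antisymm ?_ ?_
  · refine (isLUB_lexSup _).2 ?_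
    rintro _ ⟨σ, rfl⟩
    exact ((isGLB_lexInf (Set.range fun τ => p σ τ)).1 ⟨τ₀, rfl⟩).trans (h σ τ₀)
  · refine le_trans ((isGLB_lexInf (Set.range fun τ => p σ₀ τ)).2 ?_)
      ((isLUB_lexSup _).1 (Set.mem_range_self σ₀))
    rintro _ ⟨τ, rfl⟩
    exact h σ₀ τ

/-- Components outside of `I` of vectors that agree on `I` are ordered as the full vectors. -/
theorem lex_le_restrict {I : Set ι} {x y : ι → unitInterval} (hI : ∀ i ∈ I, x i = y i)
    (h : toLex x ≤ toLex y) :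
    toLex (fun i : {i // i ∉ I} => x i) ≤ toLex (fun i : {i // i ∉ I} => y i) := by
  by_contra hlt
  obtain ⟨i, hi, hi'⟩ := not_le.1 hlt
  refine absurd h (not_le.2 ⟨i, fun j hj => ?_, hi'⟩)
  by_cases hjI : j ∈ I
  · exact (hI j hjI).symm
  · exact hi ⟨j, hjI⟩ hj

variable [Fintype S] [Fintype L]

/-- The removed objectives have probability 1 (reachability) or 0 (safety) from `s` under all
strategies, so they never decide the comparison. -/
theorem lexValue_stage_eq_of_saddle (Ω : ι → Objective S) (s : S) (σ₀ : Strategy G Player.max)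
    (τ₀ : Strategy G Player.min)
    (h : ∀ (σ : Strategy G Player.max) (τ : Strategy G Player.min),
      toLex (fun i => prob G σ τ₀ s (Ω i).property) ≤
        toLex (fun i => prob G σ₀ τ s (Ω i).property)) (i : ι) (hi : i ∉ visited Ω s) :
    lexValue G (stage Ω (visited Ω s)) s ⟨i, hi⟩ = prob G σ₀ τ₀ s (Ω i).property := by
  have hsad := lexSupInf_eq_of_saddle
    (fun σ τ => toLex fun i : {i // i ∉ visited Ω s} =>
      prob G σ τ s (stage Ω (visited Ω s) i).property) σ₀ τ₀ fun σ τ => by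
    refine lex_le_restrict (fun j hj => ?_) (h σ τ)
    have hone : ∀ (σ : Strategy G Player.max) (τ : Strategy G Player.min),
        prob G σ τ s (reach (Ω j).target) = 1 := fun σ τ => Subtype.ext (prob_reach_eq_one σ τ hj)
    simp only [prob_property, hone]
  exact congrFun hsad ⟨i, hi⟩

theorem lexValue_eq_quantLexValue (G : StochasticGame S L) {n : ℕ} (Ω : Fin n → Objective S)
    (s : S) : lexValue G Ω s = quantLexValue G (quantObjectives G Ω) s := by
  obtain ⟨m, hm⟩ := exists_lex_saddle G Ω
  let D : Set S := ⋃ j, (Ω j).target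
  let σ₀ : Strategy G Player.max := memStrategy Ω m Player.max ∅
  let τ₀ : Strategy G Player.min := memStrategy Ω m Player.min ∅
  -- The same pair is used at every `t`. For safety, the complement in the weight undoes the one in
  -- the payoff.
  have hweight : ∀ i (t : D), stageWeight G Ω i t = prob G σ₀ τ₀ t (reach (Ω i).target) := by
    intro i t
    unfold stageWeight
    split_ifs with ht
    · exact Subtype.ext (prob_reach_eq_one σ₀ τ₀ ht).symm
    · have hval := lexValue_stage_eq_of_saddle Ω (t : S) σ₀ τ₀ (hm t) i ht
      rw [prob_property] at hval
      simp only [hval]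
      cases (Ω i).kind with
      | reach => rfl
      | safe => exact unitInterval.symm_symm _
  have hquant : ∀ (σ : Strategy G Player.max) (τ : Strategy G Player.min) (i : Fin n),
      (quantObjectives G Ω i).prob G σ τ s =
        prob G (σ.switch D σ₀) (τ.switch D τ₀) s (Ω i).property := by
    intro σ τ i
    have hq : prob G (σ.switch D σ₀) (τ.switch D τ₀) s (reach (Ω i).target) =
        ⟨quantReachReal G σ τ s D (stageWeight G Ω i), quantReachReal_mem _ _ _ _ _ _⟩ :=
      Subtype.ext <| prob_reach_switch (Set.subset_iUnion (fun j => (Ω j).target) i)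
        (fun x hx => memStrategy_shift_of_notMem Ω m _ hx)
        (fun x hx => memStrategy_shift_of_notMem Ω m _ hx) _
        (hweight i) σ τ s
    rw [prob_property, hq]
    rfl
  have hval := lexSupInf_eq_of_saddle
    (fun (σ : Strategy G Player.max) τ => toLex fun i => prob G σ τ s (Ω i).property) σ₀ τ₀ (hm s)
  have hqval := lexSupInf_eq_of_saddle
    -- Only the deviating player's strategy is really changed by switching, so this inequality is an
    -- instance of the saddle inequality for Ω.
    (fun (σ : Strategy G Player.max) τ => toLex fun i => (quantObjectives G Ω i).prob G σ τ s)
    σ₀ τ₀ fun σ τ => by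
      simp only [hquant]
      rw [show σ₀.switch D σ₀ = σ₀ from Strategy.switch_self D σ₀,
        show τ₀.switch D τ₀ = τ₀ from Strategy.switch_self D τ₀]
      exact hm s _ _
  refine hval.trans (Eq.trans ?_ hqval.symm)
  simp only [hquant]
  rw [Strategy.switch_self, Strategy.switch_self]

end Saddle

end LexGame

theorem mainTheorem7 {S L : Type*} [Fintype S] [Finite L] (G : LexGame.StochasticGame S L)
    {n : ℕ} (Ω : Fin n → LexGame.Objective S) :
    ∀ s : S, LexGame.lexValue G Ω s =
      LexGame.quantLexValue G (LexGame.quantObjectives G Ω) s := by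
  have := Fintype.ofFinite L
  exact LexGame.lexValue_eq_quantLexValue G Ω
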